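/- **Setting.** For $d\ge 1$ let $[d]=\{1,\dots,d\}$. A matrix $T\in\mathbb R^{d\times d}$ is symmetric Toeplitz if $T_{a,b}=T_{a',b'}$ whenever $|a-b|=|a'-b'|$; for $a=(a_0,\dots,a_{d-1})$, $\mathrm{Toep}(a)$ is the matrix with entries $a_{|j-k|}$. Let $\|\cdot\|_2$ be the spectral norm and $\|\cdot\|_F$ the Frobenius norm, and let $T_k=U_k\Sigma_kV_k^{T}$ be a rank-$k$ truncation of a singular value decomposition of $T$ (keeping the $k$ largest singular values). For $R\subseteq[d]$ let $R_s=\{(j,k)\in R\times R:|j-k|=s\}$. Algorithm 1 with ruler $R$, on independent samples $x^{(1)},\dots,x^{(n)}\sim\mathcal N(0,T)$, returns $\tilde T=\mathrm{Toep}(\tilde a)$, where $$\tilde a_s=\frac1{n|R_s|}\sum_{\ell=1}^n\sum_{(j,k)\in R_s}x^{(\ell)}_jx^{(\ell)}_k .$$ For $\alpha\in[1/2,1]$ such that $d^\alpha$ and $d^{1-\alpha}$ are integers, let $$R_\alpha=\{1,\dots,d^\alpha\}\cup\{d-i\,d^{1-\alpha}:0\le i\le d^\alpha-1\}.$$ For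 $\alpha=1/2$ and arbitrary $d$ (so $\sqrt d$ need not be an integer), the ruler $\{1,\dots,s\}\cup\{d-i s:0\le i\le s-2\}$ with $s=\lceil\sqrt d\rceil$ is also allowed as $R_{1/2}$. **Theorem.** There are universal constants $C,c>0$ such that the following hold. (1) Let $\alpha\in[1/2,1]$, let $R_\alpha$ be as above, and let $\tilde T$ be the output of Algorithm 1 with ruler $R_\alpha$ on $n$ samples. For every positive semidefinite symmetric Toeplitz $T\in\mathbb R^{d\times d}$, every $1\le k\le d$, and every $\varepsilon\in(0,1]$, $$\Pr\big[\|T-\tilde T\|_2>\varepsilon\|T\|_2\big]\le\frac{Cd^2}{\varepsilon}\exp\left(-cn\varepsilon^2\min\left(\frac1{k^2\left(1+\frac{\log d}{d^{1-\alpha}}\right)},\frac{\|T\|_2^2}{(d^{2-2\alpha}+d^{1-\alpha}\log d)\,\|T-T_k\|_2^2}\right)\right)$$ and $$\Pr\big[\|T-\tilde T\|_2>\varepsilon\|T\|_2\big]\le\frac{Cd^2}{\varepsilon}\exp\left(-cn\varepsilon^2\min\left(\frac1{k^2\left(1+\frac{\log d}{d^{1-\alpha}}\right)},\frac{\|T\|_2^2}{(d^{1-\alpha}+\log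 d)\,\|T-T_k\|_F^2}\right)\right),$$ where the second term of the minimum is $+\infty$ if $T=T_k$. (2) Let $d\ge2$, $1\le k\le d$, $\varepsilon\in(0,1]$, $\delta\in(0,1)$, and run Algorithm 1 with ruler $R_{1/2}$. There is an integer $n_0\ge 1$, depending only on $d,k,\varepsilon,\delta$ and the ruler, with $$n_0\le C\,\frac{\min(k^2,d)\log(d/(\varepsilon\delta))}{\varepsilon^2},$$ such that for every $n\ge n_0$, $\|T-\tilde T\|_2\le\varepsilon\|T\|_2$ holds with probability at least $1-\delta$ for every positive semidefinite symmetric Toeplitz $T\in\mathbb R^{d\times d}$ that has rank $k$, or satisfies $\frac{\sqrt d}{k^2}\|T-T_k\|_F^2\le\|T\|_2^2$ or $\frac{d}{k^2}\|T-T_k\|_2^2\le\|T\|_2^2$. Moreover, for every $n\ge n_0$ the maximal number of entries read in each sample (those on which the output depends) is between $c\sqrt d$ and $C\sqrt d$, and for $n=n_0$ the total number of entries read is at most $C\sqrt d\,\min(k^2,d)\log(d/(\varepsilon\delta))/\varepsilon^2$. -/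

import Mathlib

open MeasureTheory ProbabilityTheory

namespace ToeplitzRuler

/-! ### Matrices -/

/-- The distance `|j - k|` between two indices. -/
def idxDist {d : ℕ} (j k : Fin d) : ℕ := ((j : ℤ) - (k : ℤ)).natAbs

/-- `Toep(a)`, the symmetric Toeplitz matrix with entries `a_{|j-k|}`. -/
def toep {d : ℕ} (a : ℕ → ℝ) : Matrix (Fin d) (Fin d) ℝ :=
  Matrix.of fun j k => a (idxDist j k)

/-- Symmetric Toeplitz matrices: the entry `(i, j)` depends only on `|i - j|`. -/
def IsSymmToeplitz {d : ℕ} (T : Matrix (Fin d) (Fin d) ℝ) : Prop :=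
  ∀ i j k l : Fin d, idxDist i j = idxDist k l → T i j = T k l

/-- The spectral norm: the operator norm on Euclidean space. -/
noncomputable def specNorm {d : ℕ} (A : Matrix (Fin d) (Fin d) ℝ) : ℝ :=
  ‖Matrix.toEuclideanCLM (n := Fin d) (𝕜 := ℝ) A‖

/-- The Frobenius norm. -/
noncomputable def frobNorm {d : ℕ} (A : Matrix (Fin d) (Fin d) ℝ) : ℝ :=
  Real.sqrt (∑ i, ∑ j, A i j ^ 2)

/-- `Ak` is a rank-`k` truncation of `A`: for some singular value decomposition
`A = U Σ Vᵀ` (singular values in decreasing order), `Ak = U_k Σ_k V_kᵀ` keeps exactly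
the `k` largest singular values.  (If there are ties, `Ak` need not be unique.) -/
def IsTruncatedSVD {d : ℕ} (A : Matrix (Fin d) (Fin d) ℝ) (k : ℕ)
    (Ak : Matrix (Fin d) (Fin d) ℝ) : Prop :=
  ∃ U ∈ Matrix.orthogonalGroup (Fin d) ℝ, ∃ V ∈ Matrix.orthogonalGroup (Fin d) ℝ,
    ∃ σ : Fin d → ℝ, Antitone σ ∧ (∀ i, 0 ≤ σ i) ∧
      A = U * Matrix.diagonal σ * V.transpose ∧
      Ak = U * Matrix.diagonal (fun i : Fin d => if (i : ℕ) < k then σ i else 0) * V.transpose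

/-! ### Rulers

The set `[d] = {1, …, d}` is represented by `Fin d`: the mark `m` is the index with value
`m - 1`. -/

/-- The marks `{1, …, p} ∪ {d, d - q, d - 2q, …, d - (m-1)q}` in `[d]`. -/
def combRuler (d p m q : ℕ) : Finset (Fin d) :=
  Finset.univ.filter fun j => (j : ℕ) + 1 ≤ p ∨ ∃ i ∈ Finset.range m, (j : ℕ) + 1 + i * q = d

/-- The ruler `R_α = {1, …, d^α} ∪ {d - i d^(1-α) : 0 ≤ i ≤ d^α - 1}`; it is only used when
`d^α` and `d^(1-α)` are integers, so that the floors do nothing. -/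
noncomputable def alphaRuler (d : ℕ) (α : ℝ) : Finset (Fin d) :=
  combRuler d ⌊(d : ℝ) ^ α⌋₊ ⌊(d : ℝ) ^ α⌋₊ ⌊(d : ℝ) ^ (1 - α)⌋₊

/-- The ruler `{1, …, s} ∪ {d - i s : 0 ≤ i ≤ s - 2}` with `s = ⌈√d⌉`, for arbitrary `d`. -/
noncomputable def sqrtRuler (d : ℕ) : Finset (Fin d) :=
  combRuler d ⌈Real.sqrt d⌉₊ (⌈Real.sqrt d⌉₊ - 1) ⌈Real.sqrt d⌉₊

/-- `R` is the sparse ruler with exponent `α ∈ [1/2, 1]`: either `R = R_α` and `d^α`, `d^(1-α)`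
are integers, or `α = 1/2` and `R` is the ruler `sqrtRuler d`, which needs no integrality. -/
def IsAlphaRuler (d : ℕ) (α : ℝ) (R : Finset (Fin d)) : Prop :=
  (1 / 2 ≤ α ∧ α ≤ 1 ∧ (∃ p : ℕ, (d : ℝ) ^ α = p) ∧ (∃ q : ℕ, (d : ℝ) ^ (1 - α) = q) ∧
      R = alphaRuler d α) ∨
    (α = 1 / 2 ∧ R = sqrtRuler d)

/-- `R_s`, the ordered pairs of marks of `R` at distance `s`. -/
def rulerPairs {d : ℕ} (R : Finset (Fin d)) (s : ℕ) : Finset (Fin d × Fin d) :=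
  (R ×ˢ R).filter fun p => idxDist p.1 p.2 = s

/-! ### The estimator -/

/-- `ã_s`, the average of `x_j x_k` over all samples and all pairs `(j, k) ∈ R_s`. -/
noncomputable def rulerCoeff {d n : ℕ} (R : Finset (Fin d))
    (x : Fin n → EuclideanSpace ℝ (Fin d)) (s : ℕ) : ℝ :=
  1 / ((n : ℝ) * ((rulerPairs R s).card : ℝ)) *
    ∑ ℓ : Fin n, ∑ p ∈ rulerPairs R s, x ℓ p.1 * x ℓ p.2

/-- The output `T̃ = Toep(ã)` of Toeplitz covariance estimation by the ruler `R`. -/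
noncomputable def rulerEstimate {d n : ℕ} (R : Finset (Fin d))
    (x : Fin n → EuclideanSpace ℝ (Fin d)) : Matrix (Fin d) (Fin d) ℝ :=
  toep (rulerCoeff R x)

/-- The law of `n` independent samples from `N(0, T)`. -/
noncomputable def sampleLaw {d : ℕ} (n : ℕ) (T : Matrix (Fin d) (Fin d) ℝ) :
    Measure (Fin n → EuclideanSpace ℝ (Fin d)) :=
  Measure.pi fun _ => multivariateGaussian 0 T

/-- The probability that the estimate from `n` samples of `N(0, T)` has
`‖T - T̃‖₂ > ε ‖T‖₂`. -/
noncomputable def failureProb {d : ℕ} (R : Finset (Fin d)) (T : Matrix (Fin d) (Fin d) ℝ)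
    (n : ℕ) (ε : ℝ) : ℝ :=
  (sampleLaw n T).real {x | ε * specNorm T < specNorm (T - rulerEstimate R x)}

/-- The estimate from `n` samples of `N(0, T)` satisfies `‖T - T̃‖₂ ≤ ε ‖T‖₂` with
probability at least `1 - δ`. -/
def SolvesCovariance {d : ℕ} (R : Finset (Fin d)) (T : Matrix (Fin d) (Fin d) ℝ)
    (n : ℕ) (ε δ : ℝ) : Prop :=
  1 - δ ≤ (sampleLaw n T).real {x | specNorm (T - rulerEstimate R x) ≤ ε * specNorm T}

/-! ### Entries read -/

/-- The coordinates of the `ℓ`-th sample on which the output of `A` depends. -/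
def entriesRead {d n : ℕ} {β : Type*} (A : (Fin n → EuclideanSpace ℝ (Fin d)) → β)
    (ℓ : Fin n) : Set (Fin d) :=
  {j | ∃ x y : Fin n → EuclideanSpace ℝ (Fin d),
    (∀ ℓ' j', (ℓ', j') ≠ (ℓ, j) → x ℓ' j' = y ℓ' j') ∧ A x ≠ A y}

/-- Entry sample complexity: the largest number of entries read in a single sample. -/
noncomputable def entryComplexity {d n : ℕ} {β : Type*}
    (A : (Fin n → EuclideanSpace ℝ (Fin d)) → β) : ℕ :=
  Finset.univ.sup fun ℓ => (entriesRead A ℓ).ncard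

/-- Total sample complexity: the number of entries read in all samples together. -/
noncomputable def totalComplexity {d n : ℕ} {β : Type*}
    (A : (Fin n → EuclideanSpace ℝ (Fin d)) → β) : ℕ :=
  ∑ ℓ, (entriesRead A ℓ).ncard

/-- `min (a, b / t)` for `t ≥ 0`, where `b / 0` is read as `+∞`. -/
noncomputable def minRate (a b t : ℝ) : ℝ := if t = 0 then a else min a (b / t)

end ToeplitzRuler

open ToeplitzRuler

open ToeplitzRuler

/-! The error `T - T̃` is again symmetric Toeplitz. Embedding it in a circulant of order `2d - 1`
bounds its spectral norm by the largest value of its symbol on the grid `2πm/(2d-1)`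
(`specNorm_toep_le`). At each frequency the symbol of `T̃` is a sample average of `xᵀ M x`, where `M
= rulerForm R θ` is supported on `R × R`, and its mean `tr (M T)` is the symbol of `T`. A Chernoff
bound with variance proxy `tr (M T M T)` and a union over the grid then give the tail; as the grid
bound is exact, no net is needed and the prefactor is only `4d`.

The variance splits into two factors. If `uᵀ T u ≤ c |u|²` for `u` supported on `R`, then `tr (M T M
T) ≤ c² tr (M²) ≤ 4 c² coverage R` (`trace_rulerForm_mul_sq_le`). With `ρ = d^(1-α)`, counting pairs
shows `coverage R` to be of order at most `ρ² + ρ log d`.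

The saving is in `c`. The two halves of the ruler, the initial block and the comb, each have about
`ρ` disjoint translates inside `[d]`, and since `T` is Toeplitz all translates carry the same
principal submatrix. Write `T = B + E` with `B` positive semidefinite and average over the
translates: the traces of the blocks of `B` add up to at most `tr B`, so `B` contributes `tr B / ρ`,
while `E` contributes at most `‖E‖₂` or, by Cauchy–Schwarz, `‖E‖_F / √ρ`
(`quadratic_le_of_translates`). The choice `B = T_k`, whose trace is at most `k ‖T‖₂`, gives the
tail bounds and the `k²` rate, with `B = T` when the rank is `k`; the choice `B = 0` gives the rate
`d`. -/

/-! ### Exponential moments and tails of Gaussian quadratic forms. -/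

lemma gaussianPDFReal_smul_exp_mul_sq (u z : ℝ) :
    gaussianPDFReal 0 1 z • Real.exp (u * z ^ 2) =
      (√(2 * Real.pi))⁻¹ * Real.exp (-(1 / 2 - u) * z ^ 2) := by
  simp only [gaussianPDFReal, NNReal.coe_one, smul_eq_mul, mul_assoc, ← Real.exp_add]
  congr 3 <;> ring

lemma integrable_exp_mul_sq_gaussianReal {u : ℝ} (hu : u < 1 / 2) :
    Integrable (fun z => Real.exp (u * z ^ 2)) (gaussianReal 0 1) := by
  rw [gaussianReal_of_var_ne_zero _ one_ne_zero,
    integrable_withDensity_iff_integrable_smul' (measurable_gaussianPDF _ _)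
      (Filter.Eventually.of_forall fun _ => ENNReal.ofReal_lt_top)]
  simp only [toReal_gaussianPDF, gaussianPDFReal_smul_exp_mul_sq]
  exact (integrable_exp_neg_mul_sq (by linarith)).const_mul _

lemma integral_exp_mul_sq_gaussianReal {u : ℝ} (hu : u < 1 / 2) :
    ∫ z, Real.exp (u * z ^ 2) ∂(gaussianReal 0 1) = (√(1 - 2 * u))⁻¹ := by
  rw [integral_gaussianReal_eq_integral_smul one_ne_zero]
  simp only [gaussianPDFReal_smul_exp_mul_sq]
  rw [integral_const_mul, integral_gaussian, ← Real.sqrt_inv, ← Real.sqrt_inv,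
    ← Real.sqrt_mul (by positivity)]
  congr 1
  have := Real.pi_pos
  have : 1 - 2 * u ≠ 0 := by linarith
  have : 1 / 2 - u ≠ 0 := by linarith
  field_simp

/-- The value `(1 - 2u)^(-1/2)` is compared with the first-order Taylor polynomial of `log (1 -
2u)`; the condition `|2u| ≤ 1/2` keeps the remainder below `8u²`, and the square root halves it. -/
lemma integral_exp_mul_sq_gaussianReal_le {u : ℝ} (hu : 16 * u ^ 2 ≤ 1) :
    ∫ z, Real.exp (u * z ^ 2) ∂(gaussianReal 0 1) ≤ Real.exp (u + 4 * u ^ 2) := by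
  have h1 : |2 * u| ≤ 1 / 2 := abs_le_of_sq_le_sq (by nlinarith) (by norm_num)
  have h2 := abs_le.mp h1
  rw [integral_exp_mul_sq_gaussianReal (by linarith)]
  have h3 := Real.abs_log_sub_add_sum_range_le (x := 2 * u) (by linarith) 1
  have h4 : |2 * u| ^ (1 + 1) / (1 - |2 * u|) ≤ 8 * u ^ 2 := by
    rw [div_le_iff₀ (by linarith), sq_abs]
    nlinarith [sq_nonneg u]
  simp only [Finset.sum_range_one, zero_add, pow_one, Nat.cast_zero, div_one] at h3
  have h5 := (abs_le.mp (h3.trans h4)).1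
  have hpos : 0 < 1 - 2 * u := by linarith
  rw [← Real.log_le_iff_le_exp (by positivity), Real.log_inv, Real.log_sqrt hpos.le]
  linarith

lemma Matrix.IsHermitian.sum_eigenvalues_sq {ι : Type*} [Fintype ι] [DecidableEq ι]
    {A : Matrix ι ι ℝ} (hA : A.IsHermitian) :
    ∑ i, hA.eigenvalues i ^ 2 = (A * A).trace := by
  have h : A * A = Unitary.conjStarAlgAut ℝ _ hA.eigenvectorUnitary
      (Matrix.diagonal fun i => hA.eigenvalues i ^ 2) := by
    conv_lhs => rw [hA.spectral_theorem, ← map_mul, Matrix.diagonal_mul_diagonal]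
    simp [pow_two]
  rw [h, Unitary.conjStarAlgAut_apply, Matrix.trace_mul_comm, ← mul_assoc]
  simp [Matrix.trace_diagonal]

lemma Matrix.IsHermitian.dotProduct_mulVec_sum_eigenvectorBasis {ι : Type*} [Fintype ι]
    [DecidableEq ι] {A : Matrix ι ι ℝ} (hA : A.IsHermitian) (z : ι → ℝ) :
    WithLp.ofLp (∑ i, z i • hA.eigenvectorBasis i) ⬝ᵥ
      A.mulVec (WithLp.ofLp (∑ i, z i • hA.eigenvectorBasis i)) =
      ∑ i, hA.eigenvalues i * z i ^ 2 := by
  rw [← Matrix.inner_toEuclideanCLM]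
  have h : ∀ i, Matrix.toEuclideanCLM (𝕜 := ℝ) A (hA.eigenvectorBasis i) =
      hA.eigenvalues i • hA.eigenvectorBasis i := fun i => by
    apply (WithLp.ofLp_injective 2)
    rw [Matrix.ofLp_toEuclideanCLM, hA.mulVec_eigenvectorBasis]
    rfl
  simp only [map_sum, map_smul, h, smul_smul]
  rw [hA.eigenvectorBasis.orthonormal.inner_sum]
  exact Finset.sum_congr rfl fun i _ => by simp; ring

/-- The moment generating function of a Gaussian quadratic form. -/
lemma integral_exp_quadratic_stdGaussian {ι : Type*} [Fintype ι] [DecidableEq ι]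
    {A : Matrix ι ι ℝ} (hA : A.IsHermitian) {θ : ℝ} (hθ : 16 * (θ ^ 2 * (A * A).trace) ≤ 1) :
    Integrable (fun z : EuclideanSpace ℝ ι => Real.exp (θ * (z.ofLp ⬝ᵥ A.mulVec z.ofLp)))
        (stdGaussian (EuclideanSpace ℝ ι)) ∧
      ∫ z, Real.exp (θ * (z.ofLp ⬝ᵥ A.mulVec z.ofLp)) ∂(stdGaussian (EuclideanSpace ℝ ι)) ≤
        Real.exp (θ * A.trace + 4 * (θ ^ 2 * (A * A).trace)) := by
  have hcont : Continuous
      (fun z : EuclideanSpace ℝ ι => Real.exp (θ * (z.ofLp ⬝ᵥ A.mulVec z.ofLp))) := by fun_prop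
  have hmap : Measurable (fun x : ι → ℝ => ∑ i, x i • hA.eigenvectorBasis i) := by fun_prop
  have hev : ∀ i, 16 * (θ * hA.eigenvalues i) ^ 2 ≤ 1 := fun i => by
    have : hA.eigenvalues i ^ 2 ≤ (A * A).trace := by
      rw [← hA.sum_eigenvalues_sq]
      exact Finset.single_le_sum (f := fun i => hA.eigenvalues i ^ 2)
        (fun _ _ => sq_nonneg _) (Finset.mem_univ i)
    nlinarith [mul_le_mul_of_nonneg_left this (sq_nonneg θ)]
  have hlt : ∀ i, θ * hA.eigenvalues i < 1 / 2 := fun i => by nlinarith [hev i]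
  have heq : ∀ z : ι → ℝ, Real.exp (θ * (WithLp.ofLp (∑ i, z i • hA.eigenvectorBasis i) ⬝ᵥ
      A.mulVec (WithLp.ofLp (∑ i, z i • hA.eigenvectorBasis i)))) =
      ∏ i, Real.exp (θ * hA.eigenvalues i * z i ^ 2) := fun z => by
    rw [hA.dotProduct_mulVec_sum_eigenvectorBasis, ← Real.exp_sum, Finset.mul_sum]
    simp only [mul_assoc]
  -- The coordinates of a standard Gaussian are independent standard normals in every orthonormal
  -- basis; in an eigenbasis of `A` the exponential factors into one-dimensional integrals.
  rw [stdGaussian_eq_map_pi_orthonormalBasis hA.eigenvectorBasis]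
  constructor
  · rw [integrable_map_measure hcont.aestronglyMeasurable hmap.aemeasurable]
    simp only [Function.comp_def, heq]
    exact Integrable.fintype_prod fun i => integrable_exp_mul_sq_gaussianReal (hlt i)
  · rw [integral_map hmap.aemeasurable hcont.aestronglyMeasurable]
    simp only [heq]
    rw [integral_fintype_prod_eq_prod
      (fun i (z : ℝ) => Real.exp (θ * hA.eigenvalues i * z ^ 2))]
    calc _ ≤ ∏ i, Real.exp (θ * hA.eigenvalues i + 4 * (θ * hA.eigenvalues i) ^ 2) :=
          Finset.prod_le_prod (fun i _ => integral_nonneg fun _ => (Real.exp_pos _).le)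
            fun i _ => integral_exp_mul_sq_gaussianReal_le (hev i)
      _ = _ := by
          rw [← Real.exp_sum, Finset.sum_add_distrib, ← Finset.mul_sum, ← hA.sum_eigenvalues_sq,
            hA.trace_eq_sum_eigenvalues, Finset.mul_sum, Finset.mul_sum, Finset.mul_sum]
          simp [Finset.mul_sum, mul_pow]

open scoped MatrixOrder in
-- With `S = √T` the sample is `S z` for a standard Gaussian `z`, so the form becomes that of `S M
-- S`, and cyclicity of the trace removes `S`.
lemma integral_exp_quadratic_multivariateGaussian {ι : Type*} [Fintype ι] [DecidableEq ι]
    {M T : Matrix ι ι ℝ} (hM : M.IsHermitian) (hT : T.PosSemidef) {θ : ℝ}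
    (hθ : 16 * (θ ^ 2 * (M * T * M * T).trace) ≤ 1) :
    Integrable (fun z : EuclideanSpace ℝ ι => Real.exp (θ * (z.ofLp ⬝ᵥ M.mulVec z.ofLp)))
        (multivariateGaussian 0 T) ∧
      ∫ z, Real.exp (θ * (z.ofLp ⬝ᵥ M.mulVec z.ofLp)) ∂(multivariateGaussian 0 T) ≤
        Real.exp (θ * (M * T).trace + 4 * (θ ^ 2 * (M * T * M * T).trace)) := by
  set S : Matrix ι ι ℝ := CFC.sqrt T with hS
  have hSS : S * S = T := CFC.sqrt_mul_sqrt_self _ hT.nonneg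
  have hSh : S.IsHermitian := (Matrix.nonneg_iff_posSemidef.mp (CFC.sqrt_nonneg T)).1
  have hA : (S * M * S).IsHermitian := by
    have := Matrix.isHermitian_conjTranspose_mul_mul S hM
    rwa [hSh.eq] at this
  have htr : (S * M * S).trace = (M * T).trace := by
    rw [Matrix.trace_mul_comm, ← mul_assoc, hSS, Matrix.trace_mul_comm]
  have htr2 : ((S * M * S) * (S * M * S)).trace = (M * T * M * T).trace := by
    rw [show (S * M * S) * (S * M * S) = S * (M * (S * S) * M * S) by simp only [mul_assoc],
      Matrix.trace_mul_comm, mul_assoc, hSS]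
  have hq : ∀ z : EuclideanSpace ℝ ι,
      (WithLp.ofLp (0 + Matrix.toEuclideanCLM (𝕜 := ℝ) S z)) ⬝ᵥ
        M.mulVec (WithLp.ofLp (0 + Matrix.toEuclideanCLM (𝕜 := ℝ) S z)) =
      z.ofLp ⬝ᵥ (S * M * S).mulVec z.ofLp := fun z => by
    rw [zero_add, Matrix.ofLp_toEuclideanCLM, ← Matrix.mulVec_mulVec, ← Matrix.mulVec_mulVec,
      Matrix.dotProduct_mulVec z.ofLp S, ← Matrix.mulVec_transpose]
    rw [show S.transpose = S from hSh]
  have hmap : Measurable (fun x : EuclideanSpace ℝ ι => 0 + Matrix.toEuclideanCLM (𝕜 := ℝ) S x) := by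
    fun_prop
  have hcont : Continuous
      (fun z : EuclideanSpace ℝ ι => Real.exp (θ * (z.ofLp ⬝ᵥ M.mulVec z.ofLp))) := by fun_prop
  have key := integral_exp_quadratic_stdGaussian hA (θ := θ) (by rwa [htr2])
  rw [htr, htr2] at key
  rw [multivariateGaussian, integrable_map_measure hcont.aestronglyMeasurable hmap.aemeasurable,
    integral_map hmap.aemeasurable hcont.aestronglyMeasurable]
  simpa only [Function.comp_def, ← hS, hq] using key

/-- A Chernoff bound for averages of a Gaussian quadratic form over independent samples. -/
lemma sampleLaw_avg_quadratic_upper_tail {d : ℕ} {M T : Matrix (Fin d) (Fin d) ℝ}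
    (hM : M.IsHermitian) (hT : T.PosSemidef) {G t : ℝ} (hG : 0 < G)
    (hMT : (M * T * M * T).trace ≤ G) (ht : 0 ≤ t) (htG : t ^ 2 ≤ G) (n : ℕ) :
    (sampleLaw n T).real {x | n * ((M * T).trace + t) ≤
        ∑ ℓ, (x ℓ).ofLp ⬝ᵥ M.mulVec (x ℓ).ofLp} ≤ Real.exp (-(n * t ^ 2 / (16 * G))) := by
  -- This `θ` minimises `-θ t + 4 θ² G`, with value `-t² / (16 G)`; the assumption `t² ≤ G` keeps it
  -- in the range where the moment bound is valid.
  set θ := t / (8 * G) with hθdef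
  have hθ0 : 0 ≤ θ := by positivity
  have hθG : θ ^ 2 * (M * T * M * T).trace ≤ t ^ 2 / (64 * G) := by
    calc θ ^ 2 * (M * T * M * T).trace ≤ θ ^ 2 * G := by gcongr
      _ = _ := by rw [hθdef]; field_simp; ring
  have hb : t ^ 2 / (64 * G) ≤ 1 / 64 := by
    rw [div_le_div_iff₀ (by positivity) (by norm_num)]; linarith
  obtain ⟨hint, hle⟩ := integral_exp_quadratic_multivariateGaussian hM hT (θ := θ) (by linarith)
  have hprod : ∀ x : Fin n → EuclideanSpace ℝ (Fin d),
      Real.exp (θ * ∑ ℓ, (x ℓ).ofLp ⬝ᵥ M.mulVec (x ℓ).ofLp) =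
        ∏ ℓ, Real.exp (θ * ((x ℓ).ofLp ⬝ᵥ M.mulVec (x ℓ).ofLp)) := fun x => by
    rw [← Real.exp_sum, Finset.mul_sum]
  have : IsProbabilityMeasure (sampleLaw n T) := by unfold sampleLaw; infer_instance
  have hint' : Integrable (fun x : Fin n → EuclideanSpace ℝ (Fin d) =>
      Real.exp (θ * ∑ ℓ, (x ℓ).ofLp ⬝ᵥ M.mulVec (x ℓ).ofLp)) (sampleLaw n T) := by
    simp only [hprod]
    exact Integrable.fintype_prod fun _ => hint
  have hmgf : mgf (fun x : Fin n → EuclideanSpace ℝ (Fin d) =>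
      ∑ ℓ, (x ℓ).ofLp ⬝ᵥ M.mulVec (x ℓ).ofLp) (sampleLaw n T) θ ≤
      Real.exp (n * (θ * (M * T).trace + 4 * (t ^ 2 / (64 * G)))) := by
    rw [mgf]
    simp only [hprod]
    rw [sampleLaw, integral_fintype_prod_eq_prod
      (fun _ (z : EuclideanSpace ℝ (Fin d)) => Real.exp (θ * (z.ofLp ⬝ᵥ M.mulVec z.ofLp)))]
    rw [Finset.prod_const, Finset.card_univ, Fintype.card_fin, Real.exp_nat_mul]
    refine pow_le_pow_left₀ (integral_nonneg fun _ => (Real.exp_pos _).le) (hle.trans ?_) _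
    gcongr
  refine (measure_ge_le_exp_mul_mgf _ hθ0 hint').trans
    ((mul_le_mul_of_nonneg_left hmgf (Real.exp_pos _).le).trans (le_of_eq ?_))
  rw [← Real.exp_add, hθdef]
  congr 1
  field_simp
  ring

lemma sampleLaw_avg_quadratic_tail {d : ℕ} {M T : Matrix (Fin d) (Fin d) ℝ}
    (hM : M.IsHermitian) (hT : T.PosSemidef) {G t : ℝ} (hG : 0 < G)
    (hMT : (M * T * M * T).trace ≤ G) (ht : 0 ≤ t) (htG : t ^ 2 ≤ G) {n : ℕ} (hn : 0 < n) :
    (sampleLaw n T).real {x | t < |(M * T).trace -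
        (1 / n : ℝ) * ∑ ℓ, (x ℓ).ofLp ⬝ᵥ M.mulVec (x ℓ).ofLp|} ≤
      2 * Real.exp (-(n * t ^ 2 / (16 * G))) := by
  have : IsProbabilityMeasure (sampleLaw n T) := by unfold sampleLaw; infer_instance
  have hn' : (0 : ℝ) < n := Nat.cast_pos.mpr hn
  have h1 := sampleLaw_avg_quadratic_upper_tail hM hT hG hMT ht htG n
  -- The lower tail is the upper tail of `-M`, which has the same variance proxy.
  have h2 := sampleLaw_avg_quadratic_upper_tail hM.neg hT hG (by simpa using hMT) ht htG n
  rw [two_mul]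
  refine le_trans ?_ (add_le_add h1 h2)
  refine le_trans (measureReal_mono ?_) (measureReal_union_le _ _)
  intro x hx
  simp only [Set.mem_ofPred_eq, Set.mem_union, Matrix.neg_mulVec, dotProduct_neg,
    Finset.sum_neg_distrib, Matrix.neg_mul, Matrix.trace_neg] at hx ⊢
  set Q := ∑ ℓ, (x ℓ).ofLp ⬝ᵥ M.mulVec (x ℓ).ofLp
  have hQ : (n : ℝ) * ((1 / n : ℝ) * Q) = Q := by field_simp
  rcases lt_abs.mp hx with h | h
  · right; nlinarith [mul_lt_mul_of_pos_left h hn']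
  · left; nlinarith [mul_lt_mul_of_pos_left h hn']

namespace ToeplitzRuler

/-! ### The spectral norm and quadratic forms -/

lemma specNorm_nonneg {d : ℕ} (A : Matrix (Fin d) (Fin d) ℝ) : 0 ≤ specNorm A := norm_nonneg _

lemma dotProduct_self_eq_norm_sq {d : ℕ} (x : EuclideanSpace ℝ (Fin d)) :
    x.ofLp ⬝ᵥ x.ofLp = ‖x‖ ^ 2 := by
  rw [EuclideanSpace.real_norm_sq_eq]
  simp [dotProduct, pow_two]

lemma abs_quadratic_le_specNorm {d : ℕ} (A : Matrix (Fin d) (Fin d) ℝ) (u : Fin d → ℝ) :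
    |u ⬝ᵥ A.mulVec u| ≤ specNorm A * (u ⬝ᵥ u) := by
  have h := Matrix.inner_toEuclideanCLM A (WithLp.toLp 2 u) (WithLp.toLp 2 u)
  have h2 := dotProduct_self_eq_norm_sq (WithLp.toLp 2 u)
  simp only at h h2
  rw [← h, h2, pow_two, mul_comm, mul_assoc, mul_comm]
  exact (abs_real_inner_le_norm _ _).trans <| by
    rw [mul_assoc]
    calc _ ≤ ‖WithLp.toLp 2 u‖ * (specNorm A * ‖WithLp.toLp 2 u‖) := by
          gcongr; exact ContinuousLinearMap.le_opNorm _ _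
      _ = _ := by ring

lemma specNorm_le_of_quadratic {d : ℕ} {A : Matrix (Fin d) (Fin d) ℝ} (hA : A.IsHermitian)
    {M : ℝ} (hM : 0 ≤ M) (h : ∀ u : Fin d → ℝ, |u ⬝ᵥ A.mulVec u| ≤ M * (u ⬝ᵥ u)) :
    specNorm A ≤ M := by
  have hsym : (Matrix.toEuclideanCLM (n := Fin d) (𝕜 := ℝ) A).toLinearMap.IsSymmetric :=
    Matrix.isSymmetric_toEuclideanLin_iff.mpr hA
  rw [specNorm, ContinuousLinearMap.norm_eq_iSup_rayleighQuotient _ hsym]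
  refine ciSup_le fun x => ?_
  rw [ContinuousLinearMap.rayleighQuotient, abs_div, abs_sq,
    ContinuousLinearMap.reApplyInnerSelf_apply, real_inner_comm, Matrix.inner_toEuclideanCLM]
  refine div_le_of_le_mul₀ (sq_nonneg _) hM ?_
  rw [← dotProduct_self_eq_norm_sq]
  exact h _

/-! ### The symbol of a Toeplitz matrix -/

lemma idxDist_comm {d : ℕ} (j k : Fin d) : idxDist j k = idxDist k j := by
  unfold idxDist; omega

lemma idxDist_lt {d : ℕ} (j k : Fin d) : idxDist j k < d := by
  unfold idxDist; omega

lemma toep_isHermitian {d : ℕ} (a : ℕ → ℝ) : (toep a : Matrix (Fin d) (Fin d) ℝ).IsHermitian := by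
  ext j k
  simp [toep, idxDist_comm k j]

lemma toep_sub {d : ℕ} (a b : ℕ → ℝ) :
    (toep a : Matrix (Fin d) (Fin d) ℝ) - toep b = toep (a - b) := by
  ext j k; simp [toep]

lemma IsSymmToeplitz.exists_eq_toep {d : ℕ} {T : Matrix (Fin d) (Fin d) ℝ}
    (hT : IsSymmToeplitz T) : ∃ a : ℕ → ℝ, T = toep a := by
  refine ⟨fun s => if h : s < d then T ⟨0, by omega⟩ ⟨s, h⟩ else 0, ?_⟩
  ext j k
  simp only [toep, Matrix.of_apply, idxDist_lt, dite_true]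
  apply hT
  simp only [idxDist]
  omega

/-- The multiplicity of the lag `s` among the integers of absolute value `s`. -/
noncomputable def lagWeight (s : ℕ) : ℝ := if s = 0 then 1 else 2

/-- The trigonometric polynomial whose Fourier coefficients are the entries of `Toep(a)`. -/
noncomputable def symbol (d : ℕ) (a : ℕ → ℝ) (θ : ℝ) : ℝ :=
  ∑ s ∈ Finset.range d, lagWeight s * a s * Real.cos (s * θ)

lemma symbol_sub (d : ℕ) (a b : ℕ → ℝ) (θ : ℝ) :
    symbol d (a - b) θ = symbol d a θ - symbol d b θ := by
  simp only [symbol, ← Finset.sum_sub_distrib]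
  exact Finset.sum_congr rfl fun s _ => by simp; ring

/-- Real part of the geometric sum of an `N`-th root of unity other than 1. -/
lemma sum_cos_eq_zero_of_not_dvd {N : ℕ} (hN : N ≠ 0) {t : ℤ} (ht : ¬ (N : ℤ) ∣ t) :
    ∑ m ∈ Finset.range N, Real.cos (t * (2 * Real.pi * m / N)) = 0 := by
  set ζ : ℂ := Complex.exp (2 * Real.pi * Complex.I * t / N) with hζ
  have hNc : (N : ℂ) ≠ 0 := Nat.cast_ne_zero.mpr hN
  have hpow : ζ ^ N = 1 := by
    rw [hζ, ← Complex.exp_nat_mul, Complex.exp_eq_one_iff]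
    exact ⟨t, by field_simp⟩
  have hne : ζ ≠ 1 := fun h => ht <| by
    obtain ⟨n, hn⟩ := Complex.exp_eq_one_iff.mp h
    refine ⟨n, ?_⟩
    have h2 : (2 * Real.pi * Complex.I : ℂ) ≠ 0 := Complex.two_pi_I_ne_zero
    have h3 : (t : ℂ) = N * n := by
      field_simp at hn
      linear_combination hn
    exact_mod_cast h3
  have hsum : ∑ m ∈ Finset.range N, ζ ^ m = 0 := by
    rw [geom_sum_eq hne, hpow, sub_self, zero_div]
  have := congrArg Complex.re hsum
  rw [Complex.re_sum, Complex.zero_re] at this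
  rw [← this]
  refine Finset.sum_congr rfl fun m _ => ?_
  rw [hζ, ← Complex.exp_nat_mul, ← Complex.exp_ofReal_mul_I_re]
  congr 2
  push_cast
  field_simp

/-- Both `j - k + s` and `j - k - s` have absolute value at most `2d - 2`, so order `2d - 1` is just
enough to exclude aliasing. If `s = 0` the two frequencies coincide, which is why that lag has
weight 1 and the others 2. -/
lemma sum_cos_mul_lag {d : ℕ} (j k : Fin d) {s : ℕ} (hs : s < d) :
    ∑ m ∈ Finset.range (2 * d - 1),
        Real.cos (((j : ℝ) - k) * (2 * Real.pi * m / (2 * d - 1 : ℕ))) *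
          (lagWeight s * Real.cos (s * (2 * Real.pi * m / (2 * d - 1 : ℕ)))) =
      if idxDist j k = s then ((2 * d - 1 : ℕ) : ℝ) else 0 := by
  set N := 2 * d - 1 with hN
  have hN0 : N ≠ 0 := by omega
  have key : ∀ t : ℤ, |t| < N →
      ∑ m ∈ Finset.range N, Real.cos (t * (2 * Real.pi * m / N)) = if t = 0 then (N : ℝ) else 0 := by
    intro t ht
    split_ifs with h
    · simp [h]
    · exact sum_cos_eq_zero_of_not_dvd hN0 fun hd => h (Int.eq_zero_of_abs_lt_dvd hd ht)
  have hsplit : ∀ m : ℕ, Real.cos (((j : ℝ) - k) * (2 * Real.pi * m / N)) *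
      (lagWeight s * Real.cos (s * (2 * Real.pi * m / N))) =
      lagWeight s / 2 * (Real.cos ((((j : ℤ) - k + s : ℤ) : ℝ) * (2 * Real.pi * m / N)) +
        Real.cos ((((j : ℤ) - k - s : ℤ) : ℝ) * (2 * Real.pi * m / N))) := by
    intro m
    push_cast
    rw [add_mul, sub_mul _ (s : ℝ), Real.cos_add, Real.cos_sub]
    ring
  have hj := j.2
  have hk := k.2
  rw [Finset.sum_congr rfl fun m _ => hsplit m, ← Finset.mul_sum, Finset.sum_add_distrib,
    key _ (by rw [abs_lt]; omega), key _ (by rw [abs_lt]; omega)]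
  unfold lagWeight idxDist
  split_ifs <;> first | omega | (ring)

/-- The squared modulus of the Fourier transform of a real vector. -/
noncomputable def powerSpectrum {d : ℕ} (u : Fin d → ℝ) (θ : ℝ) : ℝ :=
  (∑ j, u j * Real.cos (j * θ)) ^ 2 + (∑ j, u j * Real.sin (j * θ)) ^ 2

lemma powerSpectrum_eq {d : ℕ} (u : Fin d → ℝ) (θ : ℝ) :
    powerSpectrum u θ = ∑ j : Fin d, ∑ k : Fin d, u j * u k * Real.cos (((j : ℝ) - k) * θ) := by
  rw [powerSpectrum, pow_two, pow_two, Finset.sum_mul_sum, Finset.sum_mul_sum,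
    ← Finset.sum_add_distrib]
  refine Finset.sum_congr rfl fun j _ => ?_
  rw [← Finset.sum_add_distrib]
  refine Finset.sum_congr rfl fun k _ => ?_
  rw [sub_mul, Real.cos_sub]
  ring

/-- Circulant embedding: the quadratic form of `Toep(a)` is diagonalised by the discrete Fourier
transform of order `2d - 1`. -/
lemma sum_powerSpectrum_mul_symbol {d : ℕ} (u : Fin d → ℝ) (a : ℕ → ℝ) :
    ∑ m ∈ Finset.range (2 * d - 1), powerSpectrum u (2 * Real.pi * m / (2 * d - 1 : ℕ)) *
        symbol d a (2 * Real.pi * m / (2 * d - 1 : ℕ)) =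
      (2 * d - 1 : ℕ) * (u ⬝ᵥ (toep a).mulVec u) := by
  have h : ∀ m : ℕ, powerSpectrum u (2 * Real.pi * m / (2 * d - 1 : ℕ)) *
      symbol d a (2 * Real.pi * m / (2 * d - 1 : ℕ)) =
      ∑ j : Fin d, ∑ k : Fin d, ∑ s ∈ Finset.range d, u j * u k * a s *
        (Real.cos (((j : ℝ) - k) * (2 * Real.pi * m / (2 * d - 1 : ℕ))) *
          (lagWeight s * Real.cos (s * (2 * Real.pi * m / (2 * d - 1 : ℕ))))) := fun m => by
    rw [powerSpectrum_eq, symbol, Finset.sum_mul]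
    refine Finset.sum_congr rfl fun j _ => ?_
    rw [Finset.sum_mul]
    refine Finset.sum_congr rfl fun k _ => ?_
    rw [Finset.mul_sum]
    exact Finset.sum_congr rfl fun s _ => by ring
  simp only [h]
  rw [Finset.sum_comm]
  simp only [dotProduct, Matrix.mulVec, Finset.mul_sum]
  refine Finset.sum_congr rfl fun j _ => ?_
  rw [Finset.sum_comm]
  refine Finset.sum_congr rfl fun k _ => ?_
  rw [Finset.sum_comm]
  simp only [← Finset.mul_sum]
  rw [Finset.sum_congr rfl fun s hs => by rw [sum_cos_mul_lag j k (Finset.mem_range.mp hs)]]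
  simp only [mul_ite, mul_zero, Finset.sum_ite_eq, Finset.mem_range, idxDist_lt, if_true, toep,
    Matrix.of_apply]
  ring

/-- The Rayleigh quotient of `Toep(a)` is an average of grid values of the symbol with the
nonnegative weights `powerSpectrum`. -/
lemma specNorm_toep_le {d : ℕ} (a : ℕ → ℝ) {M : ℝ} (hM : 0 ≤ M)
    (h : ∀ m ∈ Finset.range (2 * d - 1), |symbol d a (2 * Real.pi * m / (2 * d - 1 : ℕ))| ≤ M) :
    specNorm (toep a : Matrix (Fin d) (Fin d) ℝ) ≤ M := by
  refine specNorm_le_of_quadratic (toep_isHermitian a) hM fun u => ?_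
  rcases Nat.eq_zero_or_pos d with rfl | hd
  · simp [dotProduct]
  have hN : (0 : ℝ) < (2 * d - 1 : ℕ) := Nat.cast_pos.mpr (by omega)
  -- The identity matrix has symbol 1, so this case is Parseval's identity and fixes the total
  -- weight.
  have h1 := sum_powerSpectrum_mul_symbol u (fun s => if s = 0 then 1 else 0)
  have hone : (toep (fun s => if s = 0 then 1 else 0) : Matrix (Fin d) (Fin d) ℝ) = 1 := by
    ext j k
    simp only [toep, idxDist, Matrix.of_apply, Matrix.one_apply, Fin.ext_iff]
    congr 1
    simp only [eq_iff_iff]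
    omega
  have hsym : ∀ θ, symbol d (fun s => if s = 0 then 1 else 0) θ = 1 := fun θ => by
    rw [symbol, Finset.sum_eq_single_of_mem 0 (Finset.mem_range.mpr hd)]
    · simp [lagWeight]
    · intro s _ hs; simp [hs]
  simp only [hone, hsym, mul_one, Matrix.one_mulVec] at h1
  rw [← mul_le_mul_iff_right₀ hN, ← abs_of_pos hN, ← abs_mul, abs_of_pos hN,
    ← sum_powerSpectrum_mul_symbol, mul_left_comm, ← h1, Finset.mul_sum]
  refine (Finset.abs_sum_le_sum_abs _ _).trans (Finset.sum_le_sum fun m hm => ?_)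
  have hp : 0 ≤ powerSpectrum u (2 * Real.pi * m / (2 * d - 1 : ℕ)) := by
    unfold powerSpectrum; positivity
  rw [abs_mul, abs_of_nonneg hp, mul_comm]
  exact mul_le_mul_of_nonneg_right (h m hm) hp

/-! ### The estimator as a quadratic form -/

/-- The matrix of the quadratic form that gives the symbol of the estimate at `θ`. -/
noncomputable def rulerForm {d : ℕ} (R : Finset (Fin d)) (θ : ℝ) : Matrix (Fin d) (Fin d) ℝ :=
  Matrix.of fun j k => if j ∈ R ∧ k ∈ R then
    lagWeight (idxDist j k) * Real.cos (idxDist j k * θ) / (rulerPairs R (idxDist j k)).card else 0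

lemma rulerForm_isHermitian {d : ℕ} (R : Finset (Fin d)) (θ : ℝ) :
    (rulerForm R θ).IsHermitian := by
  ext j k
  simp [rulerForm, idxDist_comm k j, and_comm]

lemma sum_ruler_eq_sum_lag {d : ℕ} (R : Finset (Fin d)) (g : Fin d → Fin d → ℝ) :
    ∑ j, ∑ k, (if j ∈ R ∧ k ∈ R then g j k else 0) =
      ∑ s ∈ Finset.range d, ∑ p ∈ rulerPairs R s, g p.1 p.2 := by
  rw [← Finset.sum_product', Finset.univ_product_univ]
  have h : ∀ p : Fin d × Fin d, p.1 ∈ R ∧ p.2 ∈ R ↔ p ∈ R ×ˢ R := fun p => by simp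
  simp only [h]
  rw [Finset.sum_ite_mem, Finset.univ_inter]
  exact (Finset.sum_fiberwise_of_maps_to
    (fun p _ => Finset.mem_range.mpr (idxDist_lt p.1 p.2)) _).symm

lemma idxDist_of_mem_rulerPairs {d : ℕ} {R : Finset (Fin d)} {s : ℕ} {p : Fin d × Fin d}
    (hp : p ∈ rulerPairs R s) : idxDist p.1 p.2 = s := (Finset.mem_filter.mp hp).2

lemma sum_rulerForm_mul {d : ℕ} (R : Finset (Fin d)) (θ : ℝ) (g : Fin d → Fin d → ℝ) :
    ∑ j, ∑ k, rulerForm R θ j k * g j k =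
      ∑ s ∈ Finset.range d, lagWeight s * Real.cos (s * θ) / (rulerPairs R s).card *
        ∑ p ∈ rulerPairs R s, g p.1 p.2 := by
  simp only [rulerForm, Matrix.of_apply, ite_mul, zero_mul]
  rw [sum_ruler_eq_sum_lag R]
  refine Finset.sum_congr rfl fun s _ => ?_
  rw [Finset.mul_sum]
  exact Finset.sum_congr rfl fun p hp => by rw [idxDist_of_mem_rulerPairs hp]

lemma symbol_rulerCoeff {d n : ℕ} (R : Finset (Fin d)) (x : Fin n → EuclideanSpace ℝ (Fin d))
    (θ : ℝ) : symbol d (rulerCoeff R x) θ =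
      (1 / n : ℝ) * ∑ ℓ, (x ℓ).ofLp ⬝ᵥ (rulerForm R θ).mulVec (x ℓ).ofLp := by
  have h : ∀ ℓ, (x ℓ).ofLp ⬝ᵥ (rulerForm R θ).mulVec (x ℓ).ofLp =
      ∑ j, ∑ k, rulerForm R θ j k * (x ℓ j * x ℓ k) := fun ℓ => by
    simp only [dotProduct, Matrix.mulVec, Finset.mul_sum]
    exact Finset.sum_congr rfl fun j _ => Finset.sum_congr rfl fun k _ => by ring
  simp only [h, sum_rulerForm_mul]
  rw [Finset.sum_comm, Finset.mul_sum, symbol]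
  refine Finset.sum_congr rfl fun s _ => ?_
  rw [← Finset.mul_sum, rulerCoeff, one_div, mul_inv]
  ring

/-- Unbiasedness of the estimator. It needs every lag to be measured by `R`: a missing lag would
contribute 0 on the right through division by zero. -/
lemma symbol_eq_trace_rulerForm_mul {d : ℕ} {R : Finset (Fin d)}
    (hR : ∀ s < d, (rulerPairs R s).Nonempty) (a : ℕ → ℝ) (θ : ℝ) :
    symbol d a θ = (rulerForm R θ * toep a).trace := by
  have h : (rulerForm R θ * toep a).trace = ∑ j, ∑ k, rulerForm R θ j k * a (idxDist j k) := by
    simp only [Matrix.trace, Matrix.diag, Matrix.mul_apply, toep, Matrix.of_apply]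
    exact Finset.sum_congr rfl fun j _ => Finset.sum_congr rfl fun k _ => by
      rw [idxDist_comm k j]
  rw [h, sum_rulerForm_mul R θ (fun j k => a (idxDist j k)), symbol]
  refine Finset.sum_congr rfl fun s hs => ?_
  rw [Finset.sum_congr rfl fun p hp => by rw [idxDist_of_mem_rulerPairs hp], Finset.sum_const,
    nsmul_eq_mul]
  have : ((rulerPairs R s).card : ℝ) ≠ 0 :=
    Nat.cast_ne_zero.mpr (hR s (Finset.mem_range.mp hs)).card_ne_zero
  field_simp

/-- The coverage coefficient of a ruler. -/
noncomputable def coverage {d : ℕ} (R : Finset (Fin d)) : ℝ :=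
  ∑ s ∈ Finset.range d, ((rulerPairs R s).card : ℝ)⁻¹

lemma coverage_nonneg {d : ℕ} (R : Finset (Fin d)) : 0 ≤ coverage R :=
  Finset.sum_nonneg fun _ _ => by positivity

/-- Lag `s` occurs at `|R_s|` entries, each of square at most `4 / |R_s|²`, the 4 being the largest
`lagWeight` squared. -/
lemma trace_rulerForm_sq_le {d : ℕ} (R : Finset (Fin d)) (θ : ℝ) :
    (rulerForm R θ * rulerForm R θ).trace ≤ 4 * coverage R := by
  have h : (rulerForm R θ * rulerForm R θ).trace =
      ∑ j, ∑ k, rulerForm R θ j k * rulerForm R θ j k := by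
    simp only [Matrix.trace, Matrix.diag, Matrix.mul_apply]
    exact Finset.sum_congr rfl fun j _ => Finset.sum_congr rfl fun k _ => by
      rw [← (rulerForm_isHermitian R θ).apply k j]; simp
  rw [h, sum_rulerForm_mul R θ (fun j k => rulerForm R θ j k), coverage, Finset.mul_sum]
  refine Finset.sum_le_sum fun s _ => ?_
  have h2 : ∀ p ∈ rulerPairs R s, rulerForm R θ p.1 p.2 =
      lagWeight s * Real.cos (s * θ) / (rulerPairs R s).card := fun p hp => by
    have hm := Finset.mem_product.mp (Finset.mem_filter.mp hp).1
    simp [rulerForm, hm, idxDist_of_mem_rulerPairs hp]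
  rw [Finset.sum_congr rfl h2, Finset.sum_const, nsmul_eq_mul]
  rcases Nat.eq_zero_or_pos (rulerPairs R s).card with h0 | h0
  · simp [h0]
  have h0' : (0 : ℝ) < (rulerPairs R s).card := Nat.cast_pos.mpr h0
  have hw : (lagWeight s * Real.cos (s * θ)) ^ 2 ≤ 4 := by
    have hc := Real.cos_sq_le_one (s * θ)
    have hl : lagWeight s ^ 2 ≤ 4 := by unfold lagWeight; split_ifs <;> norm_num
    rw [mul_pow]
    nlinarith [sq_nonneg (Real.cos (s * θ)), sq_nonneg (lagWeight s)]
  calc _ = (lagWeight s * Real.cos (s * θ)) ^ 2 * ((rulerPairs R s).card : ℝ)⁻¹ := by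
        field_simp
    _ ≤ _ := by gcongr

lemma trace_mul_mul_transpose_le {ι κ : Type*} [Fintype ι] [Fintype κ] {W : Matrix ι κ ℝ}
    {T : Matrix κ κ ℝ} {c : ℝ} (h : ∀ i, W i ⬝ᵥ T.mulVec (W i) ≤ c * (W i ⬝ᵥ W i)) :
    (W * T * W.transpose).trace ≤ c * (W * W.transpose).trace := by
  simp only [Matrix.trace, Matrix.diag, Finset.mul_sum]
  refine Finset.sum_le_sum fun i _ => ?_
  have hrow : (W * T * W.transpose) i i = W i ⬝ᵥ T.mulVec (W i) := by
    rw [Matrix.dotProduct_mulVec]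
    rfl
  rw [hrow]
  exact h i

open scoped MatrixOrder in
lemma exists_hermitian_sqrt {ι : Type*} [Fintype ι] [DecidableEq ι] {T : Matrix ι ι ℝ}
    (hT : T.PosSemidef) : ∃ S : Matrix ι ι ℝ, S.transpose = S ∧ S * S = T :=
  ⟨CFC.sqrt T, (Matrix.nonneg_iff_posSemidef.mp (CFC.sqrt_nonneg T)).1,
    CFC.sqrt_mul_sqrt_self _ hT.nonneg⟩

/-- With `S = √T`, the trace is `tr ((SM) T (SM)ᵀ) ≤ c tr (M T M) ≤ c² tr (M²)`. Both inequalities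
are taken row by row, and the rows of `SM` and of `M` vanish off `R`. -/
lemma trace_rulerForm_mul_sq_le {d : ℕ} {R : Finset (Fin d)} {T : Matrix (Fin d) (Fin d) ℝ}
    (hT : T.PosSemidef) {c : ℝ} (hc : 0 ≤ c)
    (h : ∀ u : Fin d → ℝ, (∀ j ∉ R, u j = 0) → u ⬝ᵥ T.mulVec u ≤ c * (u ⬝ᵥ u)) (θ : ℝ) :
    (rulerForm R θ * T * rulerForm R θ * T).trace ≤ 4 * c ^ 2 * coverage R := by
  obtain ⟨S, hSt, hSS⟩ := exists_hermitian_sqrt hT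
  set M := rulerForm R θ with hM
  have hMt : M.transpose = M := rulerForm_isHermitian R θ
  have hM0 : ∀ i, ∀ j ∉ R, M i j = 0 := fun i j hj => by simp [hM, rulerForm, hj]
  have h1 := trace_mul_mul_transpose_le (W := S * M) (T := T) (c := c) fun i =>
    h _ fun j hj => by simp [Matrix.mul_apply, hM0 _ j hj]
  have h2 := trace_mul_mul_transpose_le (W := M) (T := T) (c := c) fun i => h _ (hM0 i)
  rw [Matrix.transpose_mul, hSt, hMt] at h1
  rw [hMt] at h2
  have e1 : (S * M * T * (M * S)).trace = (M * T * M * T).trace := by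
    rw [← mul_assoc, Matrix.trace_mul_comm, ← mul_assoc, ← mul_assoc, ← mul_assoc, hSS,
      Matrix.trace_mul_comm]
    simp only [mul_assoc]
  have e2 : (S * M * (M * S)).trace = (M * T * M).trace := by
    rw [← mul_assoc, Matrix.trace_mul_comm, ← mul_assoc, ← mul_assoc, hSS, mul_assoc,
      Matrix.trace_mul_comm, mul_assoc, Matrix.trace_mul_comm]
  rw [e1, e2] at h1
  have h3 := trace_rulerForm_sq_le R θ
  calc _ ≤ c * (c * (4 * coverage R)) := h1.trans (by gcongr; exact h2.trans (by gcongr))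
    _ = _ := by ring

/-- The failure probability of the ruler estimate, in terms of the coverage of the ruler and of a
bound `c` for the quadratic form of `T` on vectors supported on the ruler. -/
lemma failureProb_le {d : ℕ} (hd : 0 < d) {R : Finset (Fin d)} {T : Matrix (Fin d) (Fin d) ℝ}
    (hR : ∀ s < d, (rulerPairs R s).Nonempty) (hT : T.PosSemidef) (hToep : IsSymmToeplitz T)
    {c G ε : ℝ} (hc : 0 ≤ c) (hε : 0 ≤ ε)
    (h : ∀ u : Fin d → ℝ, (∀ j ∉ R, u j = 0) → u ⬝ᵥ T.mulVec u ≤ c * (u ⬝ᵥ u))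
    (hG : 0 < G) (hcG : 4 * c ^ 2 * coverage R ≤ G) (hεG : (ε * specNorm T) ^ 2 ≤ G) (n : ℕ) :
    failureProb R T n ε ≤ 4 * d * Real.exp (-(n * (ε * specNorm T) ^ 2 / (16 * G))) := by
  have : IsProbabilityMeasure (sampleLaw n T) := by unfold sampleLaw; infer_instance
  have hd' : (1 : ℝ) ≤ d := by exact_mod_cast hd
  rcases Nat.eq_zero_or_pos n with rfl | hn
  · have : failureProb R T 0 ε ≤ 1 := measureReal_le_one
    simp only [CharP.cast_eq_zero, zero_mul, zero_div, neg_zero, Real.exp_zero, mul_one]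
    linarith
  obtain ⟨a, rfl⟩ := hToep.exists_eq_toep
  set t := ε * specNorm (toep a : Matrix (Fin d) (Fin d) ℝ) with ht
  have ht0 : 0 ≤ t := mul_nonneg hε (specNorm_nonneg _)
  set θ : ℕ → ℝ := fun m => 2 * Real.pi * m / (2 * d - 1 : ℕ) with hθ
  have hsub : {x : Fin n → EuclideanSpace ℝ (Fin d) |
      t < specNorm (toep a - rulerEstimate R x)} ⊆
      ⋃ m ∈ Finset.range (2 * d - 1), {x | t < |(rulerForm R (θ m) * toep a).trace -
        (1 / n : ℝ) * ∑ ℓ, (x ℓ).ofLp ⬝ᵥ (rulerForm R (θ m)).mulVec (x ℓ).ofLp|} := by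
    intro x hx
    by_contra hcon
    simp only [Set.mem_iUnion, not_exists, Set.mem_ofPred_eq, not_lt] at hcon hx
    refine absurd hx (not_lt.mpr ?_)
    rw [rulerEstimate, toep_sub]
    refine specNorm_toep_le _ ht0 fun m hm => ?_
    rw [symbol_sub, symbol_rulerCoeff, symbol_eq_trace_rulerForm_mul hR]
    exact hcon m hm
  calc failureProb R (toep a) n ε ≤ _ := measureReal_mono hsub (measure_ne_top _ _)
    _ ≤ ∑ m ∈ Finset.range (2 * d - 1), _ := measureReal_biUnion_finset_le _ _
    _ ≤ ∑ m ∈ Finset.range (2 * d - 1), 2 * Real.exp (-(n * t ^ 2 / (16 * G))) :=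
        Finset.sum_le_sum fun m _ => sampleLaw_avg_quadratic_tail (rulerForm_isHermitian _ _) hT hG
          ((trace_rulerForm_mul_sq_le hT hc h _).trans hcG) ht0 hεG hn
    _ ≤ _ := by
        rw [Finset.sum_const, nsmul_eq_mul, Finset.card_range, ← mul_assoc]
        refine mul_le_mul_of_nonneg_right ?_ (Real.exp_pos _).le
        have : ((2 * d - 1 : ℕ) : ℝ) ≤ 2 * d := by exact_mod_cast Nat.sub_le _ _
        linarith

/-! ### Principal submatrices with many disjoint translates -/

lemma Matrix.PosSemidef.quadratic_le_trace {ι : Type*} [Fintype ι] {B : Matrix ι ι ℝ}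
    (hB : B.PosSemidef) (u : ι → ℝ) : u ⬝ᵥ B.mulVec u ≤ B.trace * (u ⬝ᵥ u) := by
  classical
  obtain ⟨S, hSt, rfl⟩ := exists_hermitian_sqrt hB
  have h1 : u ⬝ᵥ (S * S).mulVec u = ∑ i, (∑ j, S i j * u j) ^ 2 := by
    rw [← Matrix.mulVec_mulVec, Matrix.dotProduct_mulVec, ← Matrix.mulVec_transpose, hSt]
    simp [dotProduct, Matrix.mulVec, pow_two]
  have h2 : (S * S).trace = ∑ i, ∑ j, S i j ^ 2 := by
    simp only [Matrix.trace, Matrix.diag, Matrix.mul_apply, pow_two]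
    refine Finset.sum_congr rfl fun i _ => Finset.sum_congr rfl fun j _ => ?_
    rw [show S j i = S i j from congrFun (congrFun hSt i) j]
  rw [h1, h2, Finset.sum_mul]
  refine Finset.sum_le_sum fun i _ => (Finset.sum_mul_sq_le_sq_mul_sq _ _ _).trans (le_of_eq ?_)
  simp [dotProduct, pow_two]

/-- Positivity of `‖E‖₂ · 1 - E` passes to principal submatrices. -/
lemma quadratic_submatrix_le_specNorm {ι : Type*} [Fintype ι] {d : ℕ}
    {E : Matrix (Fin d) (Fin d) ℝ} (hE : E.IsHermitian) {f : ι → Fin d} (hf : f.Injective)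
    (u : ι → ℝ) : u ⬝ᵥ (E.submatrix f f).mulVec u ≤ specNorm E * (u ⬝ᵥ u) := by
  classical
  have hpsd : (specNorm E • (1 : Matrix (Fin d) (Fin d) ℝ) - E).PosSemidef := by
    refine Matrix.PosSemidef.of_dotProduct_mulVec_nonneg
      ((Matrix.isHermitian_one.smul (IsSelfAdjoint.all _)).sub hE) fun x => ?_
    have := (abs_le.mp (abs_quadratic_le_specNorm E x)).2
    simp only [star_trivial, Matrix.sub_mulVec, Matrix.smul_mulVec, Matrix.one_mulVec,
      dotProduct_sub, dotProduct_smul, smul_eq_mul]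
    linarith
  have h := (hpsd.submatrix f).dotProduct_mulVec_nonneg u
  have hs : (specNorm E • (1 : Matrix (Fin d) (Fin d) ℝ) - E).submatrix f f =
      specNorm E • (1 : Matrix ι ι ℝ) - E.submatrix f f := by
    ext i j
    simp [Matrix.one_apply, hf.eq_iff]
  rw [hs] at h
  simp only [star_trivial, Matrix.sub_mulVec, Matrix.smul_mulVec, Matrix.one_mulVec,
    dotProduct_sub, dotProduct_smul, smul_eq_mul] at h
  linarith

/-- One Cauchy–Schwarz over all triples `(v, i, j)`: the entries of `E` involved sit at distinct
positions, and the products `u i * u j` are repeated `N` times. Hence `√N` rather than `N`, a gain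
after averaging. -/
lemma sum_quadratic_submatrix_le_frobNorm {ι : Type*} [Fintype ι] {d N : ℕ}
    (E : Matrix (Fin d) (Fin d) ℝ) {φ : Fin N → ι → Fin d}
    (hφ : Function.Injective fun p : Fin N × ι => φ p.1 p.2) (u : ι → ℝ) :
    ∑ v, u ⬝ᵥ (E.submatrix (φ v) (φ v)).mulVec u ≤ √N * frobNorm E * (u ⬝ᵥ u) := by
  have h1 : ∑ v, u ⬝ᵥ (E.submatrix (φ v) (φ v)).mulVec u =
      ∑ p : Fin N × ι × ι, (u p.2.1 * u p.2.2) * E (φ p.1 p.2.1) (φ p.1 p.2.2) := by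
    simp only [Fintype.sum_prod_type, dotProduct, Matrix.mulVec, Matrix.submatrix_apply,
      Finset.mul_sum]
    refine Finset.sum_congr rfl fun v _ => Finset.sum_congr rfl fun i _ =>
      Finset.sum_congr rfl fun j _ => by ring
  have h2 : ∑ p : Fin N × ι × ι, (u p.2.1 * u p.2.2) ^ 2 = N * (u ⬝ᵥ u) ^ 2 := by
    simp only [Fintype.sum_prod_type, Finset.sum_const, Finset.card_univ, Fintype.card_fin,
      nsmul_eq_mul, pow_two, dotProduct, Finset.sum_mul_sum]
    congr 1
    refine Finset.sum_congr rfl fun i _ => Finset.sum_congr rfl fun j _ => by ring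
  have h3 : ∑ p : Fin N × ι × ι, E (φ p.1 p.2.1) (φ p.1 p.2.2) ^ 2 ≤ ∑ i, ∑ j, E i j ^ 2 := by
    classical
    rw [← Finset.sum_product', Finset.univ_product_univ]
    have hinj : Function.Injective
        (fun p : Fin N × ι × ι => (φ p.1 p.2.1, φ p.1 p.2.2)) := by
      rintro ⟨v, i, j⟩ ⟨v', i', j'⟩ h
      simp only [Prod.mk.injEq] at h
      have h1 := hφ (a₁ := (v, i)) (a₂ := (v', i')) h.1
      have h2 := hφ (a₁ := (v, j)) (a₂ := (v', j')) h.2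
      simp only [Prod.mk.injEq] at h1 h2 ⊢
      exact ⟨h1.1, h1.2, h2.2⟩
    rw [← Finset.sum_image (f := fun q : Fin d × Fin d => E q.1 q.2 ^ 2)
      (s := Finset.univ) (g := fun p : Fin N × ι × ι => (φ p.1 p.2.1, φ p.1 p.2.2))
      (hinj.injOn)]
    exact Finset.sum_le_sum_of_subset_of_nonneg (Finset.subset_univ _) fun _ _ _ => sq_nonneg _
  have hu : 0 ≤ u ⬝ᵥ u := Finset.sum_nonneg fun i _ => mul_self_nonneg _
  rw [h1]
  refine (Real.sum_mul_le_sqrt_mul_sqrt _ _ _).trans ?_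
  rw [h2, Real.sqrt_mul (by positivity), Real.sqrt_sq hu, mul_right_comm]
  exact mul_le_mul_of_nonneg_right
    (mul_le_mul_of_nonneg_left (Real.sqrt_le_sqrt h3) (Real.sqrt_nonneg _)) hu

lemma sum_trace_submatrix_le {ι : Type*} [Fintype ι] {d N : ℕ}
    {B : Matrix (Fin d) (Fin d) ℝ} (hB : B.PosSemidef) {φ : Fin N → ι → Fin d}
    (hφ : Function.Injective fun p : Fin N × ι => φ p.1 p.2) :
    ∑ v, (B.submatrix (φ v) (φ v)).trace ≤ B.trace := by
  classical
  simp only [Matrix.trace, Matrix.diag, Matrix.submatrix_apply]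
  rw [← Fintype.sum_prod_type (f := fun p : Fin N × ι => B (φ p.1 p.2) (φ p.1 p.2)),
    ← Finset.sum_image (f := fun q => B q q) (g := fun p : Fin N × ι => φ p.1 p.2) hφ.injOn]
  exact Finset.sum_le_sum_of_subset_of_nonneg (Finset.subset_univ _) fun i _ _ => hB.diag_nonneg

/-- If all the translates `φ v` of an index set have the same principal submatrix `T'` of
`B + E`, its quadratic form is controlled by the averages over `v` of those of `B` and `E`. -/
lemma quadratic_le_of_translates {ι : Type*} [Fintype ι] {d N : ℕ} (hN : 0 < N)
    {B E : Matrix (Fin d) (Fin d) ℝ} (hB : B.PosSemidef) (hE : E.IsHermitian)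
    {φ : Fin N → ι → Fin d} (hφ : Function.Injective fun p : Fin N × ι => φ p.1 p.2)
    {T' : Matrix ι ι ℝ} (hT' : ∀ v, (B + E).submatrix (φ v) (φ v) = T') (u : ι → ℝ) :
    u ⬝ᵥ T'.mulVec u ≤ (B.trace / N + min (specNorm E) (frobNorm E / √N)) * (u ⬝ᵥ u) := by
  have hN' : (0 : ℝ) < N := Nat.cast_pos.mpr hN
  have hu : 0 ≤ u ⬝ᵥ u := Finset.sum_nonneg fun i _ => mul_self_nonneg _
  have h1 : (N : ℝ) * (u ⬝ᵥ T'.mulVec u) =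
      ∑ v, u ⬝ᵥ (B.submatrix (φ v) (φ v)).mulVec u +
        ∑ v, u ⬝ᵥ (E.submatrix (φ v) (φ v)).mulVec u := by
    rw [← Finset.sum_add_distrib]
    have : ∀ v, u ⬝ᵥ (B.submatrix (φ v) (φ v)).mulVec u +
        u ⬝ᵥ (E.submatrix (φ v) (φ v)).mulVec u = u ⬝ᵥ T'.mulVec u := fun v => by
      rw [← dotProduct_add, ← Matrix.add_mulVec, ← hT' v]
      rfl
    simp [this]
  have h2 : ∑ v, u ⬝ᵥ (B.submatrix (φ v) (φ v)).mulVec u ≤ B.trace * (u ⬝ᵥ u) :=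
    calc _ ≤ ∑ v, (B.submatrix (φ v) (φ v)).trace * (u ⬝ᵥ u) :=
          Finset.sum_le_sum fun v _ => Matrix.PosSemidef.quadratic_le_trace (hB.submatrix _) u
      _ ≤ _ := by
          rw [← Finset.sum_mul]
          exact mul_le_mul_of_nonneg_right (sum_trace_submatrix_le hB hφ) hu
  have h3 : ∑ v, u ⬝ᵥ (E.submatrix (φ v) (φ v)).mulVec u ≤ N * specNorm E * (u ⬝ᵥ u) :=
    calc _ ≤ ∑ v : Fin N, specNorm E * (u ⬝ᵥ u) :=
          Finset.sum_le_sum fun v _ => quadratic_submatrix_le_specNorm hE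
            (fun i j h => (Prod.mk.inj (hφ (a₁ := (v, i)) (a₂ := (v, j)) h)).2) u
      _ = _ := by simp [mul_assoc]
  have h4 := sum_quadratic_submatrix_le_frobNorm E hφ u
  have h5 : √(N : ℝ) * frobNorm E = N * (frobNorm E / √N) := by
    have hs := Real.mul_self_sqrt hN'.le
    have : √(N : ℝ) ≠ 0 := (Real.sqrt_pos.mpr hN').ne'
    field_simp
    linear_combination (frobNorm E) * hs
  rw [h5] at h4
  rw [← mul_le_mul_iff_right₀ hN', h1]
  have h6 : (N : ℝ) * ((B.trace / N + min (specNorm E) (frobNorm E / √N)) * (u ⬝ᵥ u)) =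
      B.trace * (u ⬝ᵥ u) + N * min (specNorm E) (frobNorm E / √N) * (u ⬝ᵥ u) := by
    field_simp
  rw [h6]
  refine add_le_add h2 ?_
  rcases min_choice (specNorm E) (frobNorm E / √N) with h | h <;> rw [h] <;> assumption

/-! ### Low-rank truncations -/

open scoped MatrixOrder in
-- `U` and `V` may differ on the kernel of `T`, but `T² = (V Σ Vᵀ)²` and positive square roots are
-- unique, so `U Σ = V Σ` and the truncation is `V Σ_k Vᵀ`, with at most `k` nonzero eigenvalues,
-- each at most `‖T‖₂`.
lemma IsTruncatedSVD.posSemidef_and_trace_le {d k : ℕ} {T Tk : Matrix (Fin d) (Fin d) ℝ}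
    (hT : T.PosSemidef) (h : IsTruncatedSVD T k Tk) :
    Tk.PosSemidef ∧ Tk.trace ≤ k * specNorm T := by
  obtain ⟨U, hU, V, hV, σ, -, hσ0, hTeq, hTk⟩ := h
  have hUU : U.transpose * U = 1 := (Matrix.mem_orthogonalGroup_iff' (Fin d) ℝ).mp hU
  have hVV : V.transpose * V = 1 := (Matrix.mem_orthogonalGroup_iff' (Fin d) ℝ).mp hV
  set P := V * Matrix.diagonal σ * V.transpose with hP
  have hPpsd : P.PosSemidef :=
    (Matrix.PosSemidef.diagonal hσ0).mul_mul_conjTranspose_same V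
  have hTt : T.transpose = T := hT.1
  have hsq : T * T = P * P := by
    calc T * T = T.transpose * T := by rw [hTt]
      _ = V * Matrix.diagonal σ * (U.transpose * U) * Matrix.diagonal σ * V.transpose := by
          rw [hTeq]; simp [Matrix.transpose_mul, mul_assoc]
      _ = V * Matrix.diagonal σ * (V.transpose * V) * Matrix.diagonal σ * V.transpose := by
          rw [hUU, hVV]
      _ = P * P := by rw [hP]; simp only [mul_assoc]
  have hTP : T = P := by
    rw [← CFC.sqrt_mul_self T hT.nonneg, hsq, CFC.sqrt_mul_self P hPpsd.nonneg]
  have hUV : U * Matrix.diagonal σ = V * Matrix.diagonal σ := by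
    have := congrArg (· * V) (hTeq.symm.trans hTP)
    simpa [hP, mul_assoc, hVV] using this
  have hdiag : Matrix.diagonal (fun i : Fin d => if (i : ℕ) < k then σ i else 0) =
      Matrix.diagonal σ * Matrix.diagonal (fun i : Fin d => if (i : ℕ) < k then (1 : ℝ) else 0) := by
    rw [Matrix.diagonal_mul_diagonal]
    simp
  have hTk' : Tk =
      V * Matrix.diagonal (fun i : Fin d => if (i : ℕ) < k then σ i else 0) * V.transpose := by
    rw [hTk, hdiag, ← mul_assoc, ← mul_assoc, hUV]
  have hσle : ∀ i, σ i ≤ specNorm T := fun i => by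
    have h1 := (abs_le.mp (abs_quadratic_le_specNorm T (fun j => V j i))).2
    have h2 : (fun j => V j i) ⬝ᵥ T.mulVec (fun j => V j i) = (V.transpose * T * V) i i := by
      rw [mul_assoc]; rfl
    have h3 : (fun j => V j i) ⬝ᵥ (fun j => V j i) = (V.transpose * V) i i := rfl
    have h4 : V.transpose * T * V = Matrix.diagonal σ := by
      rw [hTP, hP]
      calc _ = (V.transpose * V) * Matrix.diagonal σ * (V.transpose * V) := by
            simp only [mul_assoc]
        _ = _ := by rw [hVV]; simp
    rw [h2, h3, h4, hVV] at h1
    simpa using h1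
  refine ⟨?_, ?_⟩
  · rw [hTk']
    exact (Matrix.PosSemidef.diagonal fun i => by
      dsimp only; split_ifs <;> simp [hσ0]).mul_mul_conjTranspose_same V
  · rw [hTk', Matrix.trace_mul_comm, ← mul_assoc, hVV, one_mul, Matrix.trace_diagonal,
      ← Finset.sum_filter]
    calc _ ≤ ∑ _i ∈ Finset.univ.filter fun i : Fin d => (i : ℕ) < k, specNorm T := Finset.sum_le_sum fun i _ => hσle i
      _ ≤ _ := by
        rw [Finset.sum_const, nsmul_eq_mul]
        refine mul_le_mul_of_nonneg_right ?_ (specNorm_nonneg _)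
        have : (Finset.univ.filter fun i : Fin d => (i : ℕ) < k).card ≤ (Finset.range k).card :=
          Finset.card_le_card_of_injOn (fun i => (i : ℕ)) (fun i hi => by simpa using hi)
            (Fin.val_injective.injOn)
        simpa using this

lemma trace_le_rank_mul_specNorm {d : ℕ} {T : Matrix (Fin d) (Fin d) ℝ} (hT : T.IsHermitian) :
    T.trace ≤ T.rank * specNorm T := by
  classical
  have hle : ∀ i, hT.eigenvalues i ≤ specNorm T := fun i => by
    have h1 := (abs_le.mp (abs_quadratic_le_specNorm T (hT.eigenvectorBasis i).ofLp)).2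
    rw [dotProduct_self_eq_norm_sq, hT.eigenvectorBasis.orthonormal.1 i] at h1
    rw [hT.eigenvalues_eq]
    simpa using h1
  have htr : T.trace = ∑ i, hT.eigenvalues i := by simpa using hT.trace_eq_sum_eigenvalues
  rw [htr, hT.rank_eq_card_non_zero_eigs, Fintype.card_subtype,
    ← Finset.sum_filter_ne_zero]
  calc _ ≤ ∑ i with hT.eigenvalues i ≠ 0, specNorm T := Finset.sum_le_sum fun i _ => hle i
    _ = _ := by rw [Finset.sum_const, nsmul_eq_mul]

lemma quadratic_eq_restrict {d : ℕ} {P : Fin d → Prop} [DecidablePred P] {u : Fin d → ℝ}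
    (hu : ∀ j, ¬ P j → u j = 0) (T : Matrix (Fin d) (Fin d) ℝ) :
    u ⬝ᵥ T.mulVec u = (fun i : {j // P j} => u i) ⬝ᵥ
      (T.submatrix (Subtype.val : {j // P j} → Fin d) Subtype.val).mulVec
        (fun i : {j // P j} => u i) := by
  have hr : ∀ i ∉ Set.range (Subtype.val : {j // P j} → Fin d), u i = 0 := fun i hi =>
    hu i fun h => hi ⟨⟨i, h⟩, rfl⟩
  simp only [dotProduct, Matrix.mulVec, Matrix.submatrix_apply]
  refine (Fintype.sum_of_injective _ Subtype.val_injective _ _ (fun i hi => by simp [hr i hi])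
    fun i => ?_).symm
  congr 1
  exact Fintype.sum_of_injective _ Subtype.val_injective _ _ (fun j hj => by simp [hr j hj])
    fun j => rfl

/-- The quadratic form of a Toeplitz matrix `B + E` on vectors supported on an index set `P`
with disjoint translates `φ v`. -/
lemma quadratic_le_of_shifts {d N : ℕ} (hN : 0 < N) {P : Fin d → Prop} [DecidablePred P]
    {B E : Matrix (Fin d) (Fin d) ℝ} (hB : B.PosSemidef) (hE : E.IsHermitian)
    (hToep : IsSymmToeplitz (B + E)) {φ : Fin N → {j // P j} → Fin d}
    (hφ : Function.Injective fun p : Fin N × {j // P j} => φ p.1 p.2)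
    (hdist : ∀ v i j, idxDist (φ v i) (φ v j) = idxDist i.1 j.1) {u : Fin d → ℝ}
    (hu : ∀ j, ¬ P j → u j = 0) :
    u ⬝ᵥ (B + E).mulVec u ≤ (B.trace / N + min (specNorm E) (frobNorm E / √N)) * (u ⬝ᵥ u) := by
  have h := quadratic_le_of_translates hN hB hE hφ
    (T' := (B + E).submatrix (Subtype.val : {j // P j} → Fin d) Subtype.val)
    (fun v => by ext i j; exact hToep _ _ _ _ (hdist v i j)) (fun i : {j // P j} => u i)
  have hone := quadratic_eq_restrict hu 1
  rw [Matrix.one_mulVec, Matrix.submatrix_one _ Subtype.val_injective, Matrix.one_mulVec] at hone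
  rwa [quadratic_eq_restrict hu, hone]

/-- The quadratic form of a Toeplitz matrix `B + E` on vectors supported on a comb ruler. -/
lemma quadratic_combRuler_le {d p m q : ℕ} (hq : 0 < q) (hqp : q ≤ p) (hpd : p ≤ d)
    {B E : Matrix (Fin d) (Fin d) ℝ} (hT : (B + E).PosSemidef) (hB : B.PosSemidef)
    (hE : E.IsHermitian) (hToep : IsSymmToeplitz (B + E)) {c : ℝ}
    (h1 : B.trace / (d / p : ℕ) + min (specNorm E) (frobNorm E / √(d / p : ℕ)) ≤ c)
    (h2 : B.trace / q + min (specNorm E) (frobNorm E / √q) ≤ c)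
    (u : Fin d → ℝ) (hu : ∀ j ∉ combRuler d p m q, u j = 0) :
    u ⬝ᵥ (B + E).mulVec u ≤ 2 * c * (u ⬝ᵥ u) := by
  have hdp : 0 < d / p := Nat.div_pos hpd (by omega)
  set u₁ : Fin d → ℝ := fun j => if (j : ℕ) < p then u j else 0 with hu₁
  set u₂ : Fin d → ℝ := fun j => if (j : ℕ) < p then 0 else u j with hu₂
  have hsum : u = u₁ + u₂ := by
    ext j; simp only [hu₁, hu₂, Pi.add_apply]; split_ifs <;> simp
  have hnorm : u₁ ⬝ᵥ u₁ + u₂ ⬝ᵥ u₂ = u ⬝ᵥ u := by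
    simp only [dotProduct, ← Finset.sum_add_distrib]
    refine Finset.sum_congr rfl fun j _ => ?_
    simp only [hu₁, hu₂]; split_ifs <;> simp
  have hself : ∀ w : Fin d → ℝ, 0 ≤ w ⬝ᵥ w := fun w =>
    Finset.sum_nonneg fun i _ => mul_self_nonneg _
  have b1 : u₁ ⬝ᵥ (B + E).mulVec u₁ ≤ c * (u₁ ⬝ᵥ u₁) := by
    -- The initial block moves right by multiples of its length `p`, which leaves room for `d / p`
    -- copies.
    refine (quadratic_le_of_shifts hdp (P := fun j => (j : ℕ) < p) hB hE hToep
      (φ := fun v i => ⟨(i : ℕ) + v * p, ?_⟩) ?_ ?_ ?_).trans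
        (mul_le_mul_of_nonneg_right h1 (hself _))
    · have hi := i.2
      have hv : ((v : ℕ) + 1) * p ≤ d / p * p := Nat.mul_le_mul_right _ v.2
      have := Nat.div_mul_le_self d p
      rw [add_mul, one_mul] at hv
      omega
    · rintro ⟨v, i⟩ ⟨v', i'⟩ h
      have h := Fin.mk.inj h
      simp only at h
      have hi : (i : ℕ) = (i' : ℕ) := by
        have := congrArg (· % p) h
        simpa [Nat.add_mul_mod_self_right, Nat.mod_eq_of_lt i.2, Nat.mod_eq_of_lt i'.2] using this
      have hv : (v : ℕ) = v' := by
        rw [hi] at h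
        exact Nat.eq_of_mul_eq_mul_right (by omega : 0 < p) (Nat.add_left_cancel h)
      exact Prod.ext (Fin.ext hv) (Subtype.ext (Fin.ext hi))
    · intro v i j
      simp only [idxDist]
      push_cast
      congr 1
      ring
    · intro j hj; simp only [hu₁]; rw [if_neg hj]
  have b2 : u₂ ⬝ᵥ (B + E).mulVec u₂ ≤ c * (u₂ ⬝ᵥ u₂) := by
    -- The comb marks agree modulo `q`, so left shifts by `0, …, q - 1` are disjoint; marks in the
    -- initial block were removed and `q ≤ p`, so the truncated subtraction is exact.
    refine (quadratic_le_of_shifts hq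
      (P := fun j => p ≤ (j : ℕ) ∧ ∃ i ∈ Finset.range m, (j : ℕ) + 1 + i * q = d) hB hE hToep
      (φ := fun v i => ⟨(i : ℕ) - v, by have := i.1.2; omega⟩) ?_ ?_ ?_).trans
        (mul_le_mul_of_nonneg_right h2 (hself _))
    · rintro ⟨v, i, hi, a, ham, ha⟩ ⟨v', i', hi', a', ham', ha'⟩ h
      replace h : (i : ℕ) - v = i' - v' := congrArg Fin.val h
      have hv := v.2
      have hv' := v'.2
      have hk : (v : ℕ) + a * q = v' + a' * q := by omega
      have hvv : (v : ℕ) = v' := by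
        have := congrArg (· % q) hk
        simpa [Nat.add_mul_mod_self_right, Nat.mod_eq_of_lt hv, Nat.mod_eq_of_lt hv'] using this
      have hii : (i : ℕ) = i' := by omega
      exact Prod.ext (Fin.ext hvv) (Subtype.ext (Fin.ext hii))
    · intro v i j
      have hi := i.2.1
      have hj := j.2.1
      have hv := v.2
      simp only [idxDist]
      omega
    · intro j hj
      simp only [hu₂]
      split_ifs with h
      · rfl
      · refine hu j fun hmem => hj ⟨by omega, ?_⟩
        have := (Finset.mem_filter.mp hmem).2
        rcases this with h' | h'
        · omega
        · exact h'
  -- Positivity at `u₁ - u₂` bounds the cross terms by the diagonal ones; this is the factor 2 in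
  -- front of `c`.
  have hpsd := hT.dotProduct_mulVec_nonneg (u₁ - u₂)
  have hcross : u₁ ⬝ᵥ (B + E).mulVec u₂ = u₂ ⬝ᵥ (B + E).mulVec u₁ := by
    rw [Matrix.dotProduct_mulVec, ← Matrix.mulVec_transpose, dotProduct_comm,
      show (B + E).transpose = B + E from hT.1]
  simp only [star_trivial, Matrix.mulVec_sub, dotProduct_sub, sub_dotProduct] at hpsd
  have hexp : u ⬝ᵥ (B + E).mulVec u = u₁ ⬝ᵥ (B + E).mulVec u₁ + u₁ ⬝ᵥ (B + E).mulVec u₂ +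
      (u₂ ⬝ᵥ (B + E).mulVec u₁ + u₂ ⬝ᵥ (B + E).mulVec u₂) := by
    rw [hsum, Matrix.mulVec_add, dotProduct_add, add_dotProduct, add_dotProduct]
    ring
  rw [hexp, ← hnorm]
  nlinarith

/-! ### Coverage of comb rulers -/

lemma mem_combRuler {d p m q : ℕ} (j : Fin d) : j ∈ combRuler d p m q ↔
    (j : ℕ) + 1 ≤ p ∨ ∃ i ∈ Finset.range m, (j : ℕ) + 1 + i * q = d := by
  simp [combRuler]

lemma mem_rulerPairs {d : ℕ} {R : Finset (Fin d)} {s : ℕ} {j k : Fin d} :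
    (j, k) ∈ rulerPairs R s ↔ (j ∈ R ∧ k ∈ R) ∧ idxDist j k = s := by
  simp [rulerPairs]

/-- Short lags lie inside the initial block. For `s ≥ p`, dividing `d - s - 1` by `q` gives a
quotient that selects a comb mark and a remainder that is the index of a mark in the initial block.
-/
lemma rulerPairs_combRuler_nonempty {d p m q : ℕ} (hq : 0 < q) (hqp : q ≤ p)
    (hd : d ≤ m * q + p) {s : ℕ} (hs : s < d) : (rulerPairs (combRuler d p m q) s).Nonempty := by
  by_cases hsp : s < p
  · refine ⟨(⟨0, by omega⟩, ⟨s, hs⟩), mem_rulerPairs.mpr ⟨⟨?_, ?_⟩, ?_⟩⟩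
    · rw [mem_combRuler]; left; dsimp only; omega
    · rw [mem_combRuler]; left; dsimp only; omega
    · simp only [idxDist]; omega
  · set a := (d - s - 1) / q with ha
    set r := (d - s - 1) % q with hr
    have hdm : q * a + r = d - s - 1 := Nat.div_add_mod _ _
    have hrq : r < q := Nat.mod_lt _ hq
    have ham : a < m := by
      rw [ha, Nat.div_lt_iff_lt_mul hq]; omega
    rw [mul_comm] at hdm
    refine ⟨(⟨r, by omega⟩, ⟨r + s, by omega⟩), mem_rulerPairs.mpr ⟨⟨?_, ?_⟩, ?_⟩⟩
    · rw [mem_combRuler]; left; dsimp only; omega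
    · rw [mem_combRuler]; right
      exact ⟨a, Finset.mem_range.mpr ham, by dsimp only; omega⟩
    · simp only [idxDist]; omega

/-- A pair at distance `s` may be moved right by multiples of `q`, until its left mark leaves the
initial block or its right mark passes `d`. -/
lemma le_card_rulerPairs_combRuler {d p m q : ℕ} (hq : 0 < q) (hd : d ≤ m * q) {s : ℕ}
    (hs : s < d) :
    min (p / q) ((d - s - 1) / q + 1) ≤ (rulerPairs (combRuler d p m q) s).card := by
  set a := (d - s - 1) / q with ha
  set r := (d - s - 1) % q with hr
  have hdm : q * a + r = d - s - 1 := Nat.div_add_mod _ _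
  have hrq : r < q := Nat.mod_lt _ hq
  have ham : a < m := by
    rw [ha, Nat.div_lt_iff_lt_mul hq]; omega
  rw [mul_comm] at hdm
  have hle : ∀ i < min (p / q) (a + 1), i * q + q ≤ p ∧ i * q ≤ a * q := fun i hi => by
    obtain ⟨h1, h2⟩ := lt_min_iff.mp hi
    refine ⟨?_, Nat.mul_le_mul_right _ (by omega)⟩
    calc i * q + q = (i + 1) * q := by ring
      _ ≤ p / q * q := Nat.mul_le_mul_right _ h1
      _ ≤ p := Nat.div_mul_le_self _ _
  have hlt : ∀ i < min (p / q) (a + 1), r + i * q + s < d := fun i hi => by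
    have := hle i hi
    omega
  have := Finset.card_le_card_of_injOn (s := Finset.univ (α := Fin (min (p / q) (a + 1))))
    (t := rulerPairs (combRuler d p m q) s)
    (fun i => (⟨r + i * q, by have := hlt i i.2; omega⟩, ⟨r + i * q + s, hlt i i.2⟩))
    (fun i _ => by
      obtain ⟨h1, h2⟩ := hle i i.2
      refine mem_rulerPairs.mpr ⟨⟨?_, ?_⟩, ?_⟩
      · rw [mem_combRuler]; left; dsimp only; omega
      · rw [mem_combRuler]; right
        refine ⟨a - i, Finset.mem_range.mpr (by omega), ?_⟩
        dsimp only
        rw [Nat.sub_mul]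
        omega
      · simp only [idxDist]; omega)
    (fun i _ j _ h => by
      simp only [Prod.mk.injEq, Fin.mk.injEq] at h
      exact Fin.ext (Nat.eq_of_mul_eq_mul_right hq (Nat.add_left_cancel h.1)))
  simpa using this

/-- The inverse of the minimum is at most the sum of the inverses. Over the `pq` lags the constant
term `2q/p` sums to `2q²`, and the other is `q` times a harmonic sum. -/
lemma coverage_combRuler_le {p q : ℕ} (hq : 0 < q) (hqp : q ≤ p) :
    coverage (combRuler (p * q) p p q) ≤ 3 * ((q : ℝ) ^ 2 + q * Real.log (p * q : ℕ)) := by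
  set d := p * q with hd
  have hp : 0 < p := by omega
  have hp' : (0 : ℝ) < p := Nat.cast_pos.mpr hp
  have hq' : (0 : ℝ) < q := Nat.cast_pos.mpr hq
  have hq1 : (1 : ℝ) ≤ q := by exact_mod_cast hq
  have hpos : 0 < p / q := Nat.div_pos hqp hq
  have hdiv : (p : ℝ) ≤ 2 * q * (p / q : ℕ) := by
    have h1 := Nat.lt_div_mul_add (a := p) hq
    have h2 : q ≤ p / q * q := Nat.le_mul_of_pos_left _ hpos
    have h3 : p ≤ 2 * q * (p / q) := by
      calc p ≤ 2 * (p / q * q) := by omega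
        _ = _ := by ring
    exact_mod_cast h3
  have hterm : ∀ s ∈ Finset.range d, ((rulerPairs (combRuler d p p q) s).card : ℝ)⁻¹ ≤
      2 * q / p + q * ((d - 1 - s + 1 : ℕ) : ℝ)⁻¹ := fun s hs => by
    have hs' := Finset.mem_range.mp hs
    have h := le_card_rulerPairs_combRuler (p := p) (m := p) hq hd.le hs'
    have hA : (0 : ℝ) < (p / q : ℕ) := Nat.cast_pos.mpr hpos
    have h1 : ((p / q : ℕ) : ℝ)⁻¹ ≤ 2 * q / p := by
      rw [inv_le_comm₀ hA (by positivity), inv_div, div_le_iff₀ (by positivity)]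
      linarith
    have ht : ((d - 1 - s + 1 : ℕ) : ℝ) ≤ q * ((d - s - 1) / q + 1 : ℕ) := by
      have h1 := Nat.lt_div_mul_add (a := d - s - 1) hq
      have h3 : d - 1 - s + 1 ≤ q * ((d - s - 1) / q + 1) := by
        calc d - 1 - s + 1 ≤ (d - s - 1) / q * q + q := by omega
          _ = _ := by ring
      exact_mod_cast h3
    have h2 : (((d - s - 1) / q + 1 : ℕ) : ℝ)⁻¹ ≤ q * ((d - 1 - s + 1 : ℕ) : ℝ)⁻¹ := by
      rw [inv_le_comm₀ (by positivity) (by positivity), mul_inv, inv_inv, inv_mul_le_iff₀ hq']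
      exact ht
    have hnn1 : (0 : ℝ) ≤ 2 * q / p := by positivity
    have hnn2 : (0 : ℝ) ≤ q * ((d - 1 - s + 1 : ℕ) : ℝ)⁻¹ := by positivity
    rcases min_choice (p / q) ((d - s - 1) / q + 1) with hm | hm <;> rw [hm] at h
    · have : ((rulerPairs (combRuler d p p q) s).card : ℝ)⁻¹ ≤ ((p / q : ℕ) : ℝ)⁻¹ :=
        inv_anti₀ hA (by exact_mod_cast h)
      linarith
    · have : ((rulerPairs (combRuler d p p q) s).card : ℝ)⁻¹ ≤
          (((d - s - 1) / q + 1 : ℕ) : ℝ)⁻¹ := inv_anti₀ (by positivity) (by exact_mod_cast h)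
      linarith
  have hharm : ∑ s ∈ Finset.range d, ((d - 1 - s + 1 : ℕ) : ℝ)⁻¹ ≤ 1 + Real.log d := by
    rw [Finset.sum_range_reflect (fun i => ((i + 1 : ℕ) : ℝ)⁻¹) d]
    have := harmonic_le_one_add_log d
    simpa [harmonic] using this
  have hlog : 0 ≤ Real.log d := Real.log_natCast_nonneg d
  calc coverage (combRuler d p p q)
      ≤ ∑ s ∈ Finset.range d, (2 * q / p + q * ((d - 1 - s + 1 : ℕ) : ℝ)⁻¹) :=
        Finset.sum_le_sum hterm
    _ = 2 * (q : ℝ) ^ 2 + q * ∑ s ∈ Finset.range d, ((d - 1 - s + 1 : ℕ) : ℝ)⁻¹ := by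
        rw [Finset.sum_add_distrib, ← Finset.mul_sum, Finset.sum_const, Finset.card_range,
          nsmul_eq_mul, hd]
        push_cast
        field_simp
    _ ≤ 2 * (q : ℝ) ^ 2 + q * (1 + Real.log d) := by gcongr
    _ ≤ _ := by nlinarith [mul_nonneg hq'.le hlog]

lemma coverage_le_of_nonempty {d : ℕ} {R : Finset (Fin d)}
    (hR : ∀ s < d, (rulerPairs R s).Nonempty) : coverage R ≤ d := by
  calc coverage R ≤ ∑ s ∈ Finset.range d, (1 : ℝ) := Finset.sum_le_sum fun s hs => by
        have : 0 < (rulerPairs R s).card := (hR s (Finset.mem_range.mp hs)).card_pos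
        exact inv_le_one_of_one_le₀ (by exact_mod_cast this)
    _ = d := by simp

lemma combRuler_card_le (d p m q : ℕ) : (combRuler d p m q).card ≤ p + m := by
  have hsub : (combRuler d p m q).image (fun j : Fin d => (j : ℕ)) ⊆
      Finset.range p ∪ (Finset.range m).image fun i => d - 1 - i * q := by
    intro x hx
    obtain ⟨j, hj, rfl⟩ := Finset.mem_image.mp hx
    rcases (mem_combRuler j).mp hj with h | ⟨i, hi, h⟩
    · exact Finset.mem_union_left _ (Finset.mem_range.mpr (by omega))
    · exact Finset.mem_union_right _ (Finset.mem_image.mpr ⟨i, hi, by omega⟩)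
  rw [← Finset.card_image_of_injective _ Fin.val_injective]
  refine (Finset.card_le_card hsub).trans ((Finset.card_union_le _ _).trans ?_)
  exact add_le_add (Finset.card_range p).le (Finset.card_image_le.trans (Finset.card_range m).le)

lemma le_combRuler_card {d p : ℕ} (m q : ℕ) (hp : p ≤ d) : p ≤ (combRuler d p m q).card := by
  have := Finset.card_le_card_of_injOn (s := Finset.univ (α := Fin p)) (t := combRuler d p m q)
    (fun i => Fin.castLE hp i)
    (fun i _ => by rw [Finset.mem_coe, mem_combRuler]; left; simp)
    (fun i _ j _ h => Fin.castLE_injective hp h)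
  simpa using this

/-! ### The rulers `R_α` -/

/-- The ruler with exponent `α` is a comb with spacings of order `d ^ (1 - α)`. -/
lemma IsAlphaRuler.exists_combRuler {d : ℕ} (hd : 0 < d) {α : ℝ} {R : Finset (Fin d)}
    (hR : IsAlphaRuler d α R) :
    ∃ p m q : ℕ, R = combRuler d p m q ∧ 0 < q ∧ q ≤ p ∧ p ≤ d ∧ d ≤ m * q + p ∧
      (d : ℝ) ^ (1 - α) ≤ 3 * q ∧ (d : ℝ) ^ (1 - α) ≤ 3 * (d / p : ℕ) ∧
      coverage R ≤ 3 * (((d : ℝ) ^ (1 - α)) ^ 2 + (d : ℝ) ^ (1 - α) * Real.log d) ∧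
      (α = 1 / 2 → √d ≤ p ∧ (p + m : ℝ) ≤ 4 * √d) := by
  have hd0 : (0 : ℝ) < d := Nat.cast_pos.mpr hd
  have hd1 : (1 : ℝ) ≤ d := by exact_mod_cast hd
  have hlog : 0 ≤ Real.log d := Real.log_natCast_nonneg d
  rcases hR with ⟨hα, hα1, ⟨p, hp⟩, ⟨q, hq⟩, rfl⟩ | ⟨rfl, rfl⟩
  · have hpq : p * q = d := by
      have : (p : ℝ) * q = d := by
        rw [← hp, ← hq, ← Real.rpow_add hd0, add_sub_cancel, Real.rpow_one]
      exact_mod_cast this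
    have hq0 : 0 < q := by
      have : (0 : ℝ) < q := hq ▸ Real.rpow_pos_of_pos hd0 _
      exact_mod_cast this
    have hqp : q ≤ p := by
      have : (q : ℝ) ≤ p := by
        rw [← hp, ← hq]; exact Real.rpow_le_rpow_of_exponent_le hd1 (by linarith)
      exact_mod_cast this
    have hR : alphaRuler d α = combRuler d p p q := by
      rw [alphaRuler, hp, hq, Nat.floor_natCast, Nat.floor_natCast]
    have hdp : d / p = q := by rw [← hpq, Nat.mul_div_cancel_left _ (by omega)]
    have hqr : (0 : ℝ) < q := Nat.cast_pos.mpr hq0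
    rw [hR, hq]
    refine ⟨p, p, q, rfl, hq0, hqp, ?_, by omega, by linarith, by rw [hdp]; linarith, ?_, ?_⟩
    · rw [← hpq]; exact Nat.le_mul_of_pos_right _ hq0
    · subst hpq
      exact coverage_combRuler_le hq0 hqp
    · rintro rfl
      rw [Real.sqrt_eq_rpow, hp]
      have : (0 : ℝ) ≤ p := Nat.cast_nonneg _
      exact ⟨le_rfl, by linarith⟩
  · set s := ⌈√(d : ℝ)⌉₊ with hs
    have hsq : √(d : ℝ) * √d = d := Real.mul_self_sqrt hd0.le
    have hs1 : (1 : ℝ) ≤ √d := Real.one_le_sqrt.mpr hd1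
    have hle : √(d : ℝ) ≤ s := Nat.le_ceil _
    have hlt : (s : ℝ) < √d + 1 := Nat.ceil_lt_add_one (Real.sqrt_nonneg _)
    have hs0 : 0 < s := by
      have : (0 : ℝ) < s := by linarith
      exact_mod_cast this
    have hsd : s ≤ d := Nat.ceil_le.mpr (by nlinarith)
    have hds : d ≤ (s - 1) * s + s := by
      have h1 : d ≤ s * s := by
        have : (d : ℝ) ≤ s * s := by nlinarith
        exact_mod_cast this
      obtain ⟨r, hr⟩ : ∃ r, s = r + 1 := ⟨s - 1, by omega⟩
      rw [hr] at h1 ⊢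
      simp only [Nat.add_sub_cancel]
      nlinarith
    have hpow : (d : ℝ) ^ (1 - 1 / 2 : ℝ) = √d := by
      rw [Real.sqrt_eq_rpow]; norm_num
    have hcov := coverage_le_of_nonempty (R := sqrtRuler d)
      fun t ht => rulerPairs_combRuler_nonempty hs0 le_rfl hds ht
    rw [hpow]
    refine ⟨s, s - 1, s, rfl, hs0, le_rfl, hsd, hds, by linarith, ?_, ?_, fun _ => ⟨hle, ?_⟩⟩
    · have hN1 : (1 : ℝ) ≤ (d / s : ℕ) := by exact_mod_cast Nat.div_pos hsd hs0
      -- For `√d ≤ 3` it suffices that `d / s ≥ 1`; beyond that, `d / s < √d / 3` would contradict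
      -- `d ≤ (d / s + 1)(√d + 1)`.
      by_cases h3 : √(d : ℝ) ≤ 3
      · linarith
      · have h4 : (d : ℝ) ≤ (d / s : ℕ) * s + s := by
          exact_mod_cast (Nat.lt_div_mul_add (a := d) hs0).le
        have hN0 : (0 : ℝ) ≤ (d / s : ℕ) + 1 := by positivity
        have h5 : √(d : ℝ) * √d ≤ ((d / s : ℕ) + 1) * (√d + 1) := by
          nlinarith [mul_le_mul_of_nonneg_left hlt.le hN0]
        by_contra hcon
        nlinarith
    · nlinarith [mul_nonneg (Real.sqrt_nonneg d) hlog]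
    · have : ((s - 1 : ℕ) : ℝ) = s - 1 := by rw [Nat.cast_sub hs0]; simp
      rw [this]; linarith

lemma IsAlphaRuler.rulerPairs_nonempty {d : ℕ} (hd : 0 < d) {α : ℝ} {R : Finset (Fin d)}
    (hR : IsAlphaRuler d α R) : ∀ s < d, (rulerPairs R s).Nonempty := by
  obtain ⟨p, m, q, rfl, hq, hqp, -, hdm, -⟩ := hR.exists_combRuler hd
  exact fun s hs => rulerPairs_combRuler_nonempty hq hqp hdm hs

/-- The samples vanish almost surely. This case is separate because the Chernoff bound needs a
positive `G`. -/
lemma failureProb_zero {d : ℕ} (R : Finset (Fin d)) (n : ℕ) {ε : ℝ} :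
    failureProb R 0 n ε = 0 := by
  have hdirac : multivariateGaussian 0 (0 : Matrix (Fin d) (Fin d) ℝ) = Measure.dirac 0 := by
    simp [multivariateGaussian, Measure.map_const]
  have hae : ∀ᵐ x ∂(sampleLaw n (0 : Matrix (Fin d) (Fin d) ℝ)), x = 0 := by
    have h : ∀ ℓ : Fin n, ∀ᵐ x ∂(sampleLaw n (0 : Matrix (Fin d) (Fin d) ℝ)), x ℓ = 0 := by
      intro ℓ
      refine (Measure.quasiMeasurePreserving_eval _ ℓ).ae (p := fun z => z = 0) ?_
      rw [hdirac, ae_dirac_eq]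
      rfl
    filter_upwards [ae_all_iff.mpr h] with x hx
    exact funext hx
  have : IsProbabilityMeasure (sampleLaw n (0 : Matrix (Fin d) (Fin d) ℝ)) := by
    unfold sampleLaw; infer_instance
  rw [failureProb, measureReal_eq_zero_iff]
  refine measure_mono_null (fun x hx => ?_) (ae_iff.mp hae)
  intro h0
  have : rulerEstimate R x = 0 := by
    ext j k
    simp [h0, rulerEstimate, toep, rulerCoeff]
  simp [this, specNorm] at hx

/-- The tail bound for a covariance matrix split into a part `B` of small trace and a rest `E`. -/
lemma failureProb_le_of_add {d : ℕ} (hd : 0 < d) {α : ℝ} {R : Finset (Fin d)}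
    (hR : IsAlphaRuler d α R) {T B E : Matrix (Fin d) (Fin d) ℝ} (hT : T.PosSemidef)
    (hToep : IsSymmToeplitz T) (hTBE : T = B + E) (hB : B.PosSemidef) {κ e G ε : ℝ} (hκ : 0 ≤ κ)
    (hBκ : B.trace ≤ κ * specNorm T) (he : 0 ≤ e)
    (hEe : specNorm E ≤ e ∨ 3 * frobNorm E ^ 2 ≤ (d : ℝ) ^ (1 - α) * e ^ 2)
    (hε : 0 < ε) (hε1 : ε ≤ 1) (hG : 0 < G) (hTG : specNorm T ^ 2 ≤ G)
    (hκG : 864 * (κ ^ 2 * specNorm T ^ 2 * (1 + Real.log d / (d : ℝ) ^ (1 - α))) +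
      96 * (e ^ 2 * (((d : ℝ) ^ (1 - α)) ^ 2 + (d : ℝ) ^ (1 - α) * Real.log d)) ≤ G) (n : ℕ) :
    failureProb R T n ε ≤ 4 * d * Real.exp (-(n * (ε * specNorm T) ^ 2 / (16 * G))) := by
  have hne := hR.rulerPairs_nonempty hd
  obtain ⟨p, m, q, hRc, hq, hqp, hpd, -, hρq, hρp, hcov, -⟩ := hR.exists_combRuler hd
  subst hTBE
  have hE : E.IsHermitian := by
    have := hT.1.sub hB.1
    rwa [add_sub_cancel_left] at this
  have hd0 : (0 : ℝ) < d := Nat.cast_pos.mpr hd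
  have hlog : 0 ≤ Real.log d := Real.log_natCast_nonneg d
  have hρ : 0 < (d : ℝ) ^ (1 - α) := Real.rpow_pos_of_pos hd0 _
  set ρ := (d : ℝ) ^ (1 - α) with hρdef
  set τ := specNorm (B + E) with hτdef
  have hτ : 0 ≤ τ := specNorm_nonneg _
  -- The 3 is the loss in `ρ ≤ 3 N` for the number `N` of translates.
  set c := 3 * κ * τ / ρ + e with hc
  have hc0 : 0 ≤ c := by positivity
  have hN : ∀ N : ℕ, ρ ≤ 3 * N →
      B.trace / N + min (specNorm E) (frobNorm E / √N) ≤ c := fun N hN => by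
    have hN0 : (0 : ℝ) < N := by linarith
    refine add_le_add ?_ ?_
    · rw [div_le_div_iff₀ hN0 hρ]
      calc B.trace * ρ ≤ κ * τ * ρ := by gcongr
        _ ≤ κ * τ * (3 * N) := by gcongr
        _ = _ := by ring
    · rcases hEe with h | h
      · exact (min_le_left _ _).trans h
      · refine (min_le_right _ _).trans ?_
        rw [div_le_iff₀ (Real.sqrt_pos.mpr hN0)]
        refine le_of_sq_le_sq ?_ (by positivity)
        rw [mul_pow, Real.sq_sqrt hN0.le]
        nlinarith [mul_le_mul_of_nonneg_right hN (sq_nonneg e)]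
  refine failureProb_le hd hne hT hToep (c := 2 * c) (by positivity) hε.le ?_ hG ?_ ?_ n
  · intro u hu
    rw [hRc] at hu
    exact quadratic_combRuler_le hq hqp hpd hT hB hE hToep (hN _ hρp) (hN _ hρq) u hu
  · refine le_trans ?_ hκG
    have hc2 : c ^ 2 ≤ 2 * (3 * κ * τ / ρ) ^ 2 + 2 * e ^ 2 := by
      rw [hc]; nlinarith [sq_nonneg (3 * κ * τ / ρ - e)]
    have hD : 0 ≤ ρ ^ 2 + ρ * Real.log d := by positivity
    calc 4 * (2 * c) ^ 2 * coverage R = 16 * c ^ 2 * coverage R := by ring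
      _ ≤ 16 * (2 * (3 * κ * τ / ρ) ^ 2 + 2 * e ^ 2) * (3 * (ρ ^ 2 + ρ * Real.log d)) := by
          gcongr
          exact coverage_nonneg R
      _ = _ := by field_simp; ring
  · rw [mul_pow]
    refine le_trans ?_ hTG
    exact mul_le_of_le_one_left (sq_nonneg _) (pow_le_one₀ hε.le hε1)

/-! ### The tail bounds -/

/-- A minimum is at most twice `(1/a + t/b)⁻¹`, the form in which the variance bound, a sum of two
terms, appears. -/
lemma minRate_le {a b t : ℝ} (ha : 0 < a) (hb : 0 < b) (ht : 0 ≤ t) :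
    minRate a b t ≤ 2 * (b / (b / a + t)) := by
  have hpos : 0 < b / a + t := by positivity
  rw [minRate]
  split_ifs with h
  · rw [h, add_zero, div_div_cancel₀ hb.ne']; linarith
  · have ht' : 0 < t := lt_of_le_of_ne ht (Ne.symm h)
    rw [← mul_div_assoc, le_div_iff₀ hpos]
    have h1 : min a (b / t) * (b / a) ≤ b :=
      (mul_le_mul_of_nonneg_right (min_le_left _ _) (by positivity)).trans
        (by rw [mul_div_cancel₀ _ ha.ne'])
    have h2 : min a (b / t) * t ≤ b :=
      (mul_le_mul_of_nonneg_right (min_le_right _ _) ht).trans (by rw [div_mul_cancel₀ _ ht'.ne'])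
    linarith [mul_add (min a (b / t)) (b / a) t]

lemma tail_le_minRate {d n : ℕ} (hd : 0 < d) {a b t ε P : ℝ} (ha : 0 < a) (hb : 0 < b)
    (ht : 0 ≤ t) (hε : 0 < ε) (hε1 : ε ≤ 1)
    (hP : P ≤ 4 * d * Real.exp (-(n * (ε ^ 2 * b) / (16 * (960 * (b / a + t)))))) :
    P ≤ 1000000 * (d : ℝ) ^ 2 / ε * Real.exp (-(1 / 30720 * n * ε ^ 2 * minRate a b t)) := by
  have hd1 : (1 : ℝ) ≤ d := by exact_mod_cast hd
  have hpos : 0 < b / a + t := by positivity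
  refine hP.trans (mul_le_mul ?_ (Real.exp_le_exp.mpr (neg_le_neg ?_)) (Real.exp_pos _).le
    (by positivity))
  · rw [le_div_iff₀ hε]
    nlinarith
  · have := minRate_le ha hb ht
    calc _ ≤ 1 / 30720 * n * ε ^ 2 * (2 * (b / (b / a + t))) := by gcongr
      _ = _ := by field_simp; ring

lemma specNorm_pos_of_ne_zero {d : ℕ} {T : Matrix (Fin d) (Fin d) ℝ} (hT : T ≠ 0) :
    0 < specNorm T := by
  rw [specNorm, norm_pos_iff]
  exact fun h => hT ((map_eq_zero_iff _ (Matrix.toEuclideanCLM (n := Fin d) (𝕜 := ℝ)).injective).mp h)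

lemma frobNorm_nonneg {d : ℕ} (A : Matrix (Fin d) (Fin d) ℝ) : 0 ≤ frobNorm A :=
  Real.sqrt_nonneg _

theorem failureProb_le_tails {d k n : ℕ} {α ε : ℝ} {R : Finset (Fin d)}
    {T Tk : Matrix (Fin d) (Fin d) ℝ} (hk : 1 ≤ k) (hkd : k ≤ d) (hR : IsAlphaRuler d α R)
    (hε : 0 < ε) (hε1 : ε ≤ 1) (hT : T.PosSemidef) (hToep : IsSymmToeplitz T)
    (hTk : IsTruncatedSVD T k Tk) :
    failureProb R T n ε ≤ 1000000 * (d : ℝ) ^ 2 / ε *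
        Real.exp (-(1 / 30720 * n * ε ^ 2 *
          minRate (1 / ((k : ℝ) ^ 2 * (1 + Real.log d / (d : ℝ) ^ (1 - α)))) (specNorm T ^ 2)
            (((d : ℝ) ^ (2 - 2 * α) + (d : ℝ) ^ (1 - α) * Real.log d) *
              specNorm (T - Tk) ^ 2))) ∧
      failureProb R T n ε ≤ 1000000 * (d : ℝ) ^ 2 / ε *
        Real.exp (-(1 / 30720 * n * ε ^ 2 *
          minRate (1 / ((k : ℝ) ^ 2 * (1 + Real.log d / (d : ℝ) ^ (1 - α)))) (specNorm T ^ 2)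
            (((d : ℝ) ^ (1 - α) + Real.log d) * frobNorm (T - Tk) ^ 2))) := by
  have hd : 0 < d := by omega
  have hd0 : (0 : ℝ) < d := Nat.cast_pos.mpr hd
  by_cases hT0 : T = 0
  · subst hT0
    rw [failureProb_zero]
    exact ⟨by positivity, by positivity⟩
  have hτ := specNorm_pos_of_ne_zero hT0
  have hlog : 0 ≤ Real.log d := Real.log_natCast_nonneg d
  have hρ : 0 < (d : ℝ) ^ (1 - α) := Real.rpow_pos_of_pos hd0 _
  have hρ2 : (d : ℝ) ^ (2 - 2 * α) = ((d : ℝ) ^ (1 - α)) ^ 2 := by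
    rw [← Real.rpow_natCast, ← Real.rpow_mul hd0.le]; congr 1; push_cast; ring
  rw [hρ2]
  obtain ⟨hpsd, htr⟩ := hTk.posSemidef_and_trace_le hT
  have hk1 : (1 : ℝ) ≤ k := by exact_mod_cast hk
  set ρ := (d : ℝ) ^ (1 - α) with hρdef
  set τ := specNorm T with hτdef
  set w := (k : ℝ) ^ 2 * (1 + Real.log d / ρ) with hw
  have hw1 : 1 ≤ w := by
    have : 0 ≤ Real.log d / ρ := by positivity
    rw [hw]; nlinarith
  have hw0 : 0 < w := by linarith
  have hτw : τ ^ 2 / (1 / w) = τ ^ 2 * w := by rw [div_div_eq_mul_div, div_one]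
  have hτw1 : τ ^ 2 ≤ τ ^ 2 * w := le_mul_of_one_le_right (sq_nonneg _) hw1
  have hτ2 : 0 < τ ^ 2 := by positivity
  have hsum : T = Tk + (T - Tk) := (add_sub_cancel _ _).symm
  have hF := frobNorm_nonneg (T - Tk)
  constructor
  · have ht : 0 ≤ (ρ ^ 2 + ρ * Real.log d) * specNorm (T - Tk) ^ 2 := by positivity
    refine tail_le_minRate hd (by positivity) hτ2 ht hε hε1 ?_
    rw [hτw, ← mul_pow]
    refine failureProb_le_of_add hd hR hT hToep hsum hpsd (Nat.cast_nonneg k) htr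
      (specNorm_nonneg (T - Tk)) (Or.inl le_rfl) hε hε1 (by positivity) (by linarith) ?_ n
    have : (k : ℝ) ^ 2 * τ ^ 2 * (1 + Real.log d / ρ) = τ ^ 2 * w := by rw [hw]; ring
    rw [this]
    nlinarith
  · have ht : 0 ≤ (ρ + Real.log d) * frobNorm (T - Tk) ^ 2 := by positivity
    refine tail_le_minRate hd (by positivity) hτ2 ht hε hε1 ?_
    rw [hτw, ← mul_pow]
    -- This `e` gives equality in the Frobenius alternative `3 ‖E‖_F² ≤ ρ e²`.
    have he : √(3 * frobNorm (T - Tk) ^ 2 / ρ) ^ 2 = 3 * frobNorm (T - Tk) ^ 2 / ρ :=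
      Real.sq_sqrt (by positivity)
    refine failureProb_le_of_add hd hR hT hToep hsum hpsd (Nat.cast_nonneg k) htr
      (Real.sqrt_nonneg (3 * frobNorm (T - Tk) ^ 2 / ρ)) (Or.inr ?_) hε hε1 (by positivity)
      (by linarith) ?_ n
    · rw [he, mul_div_cancel₀ _ hρ.ne']
    · have h1 : (k : ℝ) ^ 2 * τ ^ 2 * (1 + Real.log d / ρ) = τ ^ 2 * w := by rw [hw]; ring
      have h2 : 3 * frobNorm (T - Tk) ^ 2 / ρ * (ρ ^ 2 + ρ * Real.log d) =
          3 * ((ρ + Real.log d) * frobNorm (T - Tk) ^ 2) := by field_simp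
      rw [he, h1, h2]
      nlinarith

/-! ### Entries read -/

lemma entriesRead_rulerEstimate {d n : ℕ} (R : Finset (Fin d)) (ℓ : Fin n) :
    entriesRead (rulerEstimate (n := n) R) ℓ = (R : Set (Fin d)) := by
  ext j
  constructor
  · rintro ⟨x, y, hxy, hne⟩
    by_contra hj
    refine hne ?_
    have hc : rulerCoeff R x = rulerCoeff R y := by
      funext s
      unfold rulerCoeff
      congr 1
      refine Finset.sum_congr rfl fun ℓ' _ => Finset.sum_congr rfl fun p hp => ?_
      have hp' := (mem_rulerPairs (j := p.1) (k := p.2)).mp hp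
      have hne : ∀ i ∈ R, (ℓ', i) ≠ (ℓ, j) := fun i hi h => hj (by
        rw [← (Prod.mk.inj h).2]; exact hi)
      rw [hxy _ _ (hne _ hp'.1.1), hxy _ _ (hne _ hp'.1.2)]
    rw [rulerEstimate, rulerEstimate, hc]
  · intro hj
    -- Changing the single entry `(ℓ, j)` of the zero sample to 1 makes the coefficient at lag 0
    -- positive.
    set y : Fin n → EuclideanSpace ℝ (Fin d) :=
      fun ℓ' => WithLp.toLp 2 fun j' => if (ℓ', j') = (ℓ, j) then 1 else 0 with hy
    refine ⟨0, y, fun ℓ' j' h => by simp only [hy]; rw [if_neg h]; rfl, fun h => ?_⟩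
    have h0 := congrFun (congrFun h j) j
    have hjj : idxDist j j = 0 := by simp [idxDist]
    simp only [rulerEstimate, toep, Matrix.of_apply, hjj, rulerCoeff, Pi.zero_apply,
      PiLp.zero_apply, mul_zero, Finset.sum_const_zero] at h0
    have hmem : (j, j) ∈ rulerPairs R 0 := mem_rulerPairs.mpr ⟨⟨hj, hj⟩, hjj⟩
    have hcard : (0 : ℝ) < (rulerPairs R 0).card := Nat.cast_pos.mpr (Finset.card_pos.mpr ⟨_, hmem⟩)
    have hn : (0 : ℝ) < n := Nat.cast_pos.mpr ℓ.pos
    have hnn : ∀ ℓ' (p : Fin d × Fin d), 0 ≤ y ℓ' p.1 * y ℓ' p.2 := fun ℓ' p => by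
      simp only [hy]
      refine mul_nonneg ?_ ?_ <;> · split_ifs <;> norm_num
    have hpos : 0 < ∑ ℓ', ∑ p ∈ rulerPairs R 0, y ℓ' p.1 * y ℓ' p.2 := by
      refine Finset.sum_pos' (fun ℓ' _ => Finset.sum_nonneg fun p _ => hnn ℓ' p)
        ⟨ℓ, Finset.mem_univ _, Finset.sum_pos' (fun p _ => hnn ℓ p) ⟨(j, j), hmem, ?_⟩⟩
      simp [hy]
    exact absurd h0 (mul_pos (one_div_pos.mpr (mul_pos hn hcard)) hpos).ne

lemma entryComplexity_rulerEstimate {d n : ℕ} (hn : 0 < n) (R : Finset (Fin d)) :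
    entryComplexity (rulerEstimate (n := n) R) = R.card := by
  simp only [entryComplexity, entriesRead_rulerEstimate, Set.ncard_coe_finset]
  exact Finset.sup_const ⟨⟨0, hn⟩, Finset.mem_univ _⟩ _

lemma totalComplexity_rulerEstimate {d n : ℕ} (R : Finset (Fin d)) :
    totalComplexity (rulerEstimate (n := n) R) = n * R.card := by
  simp [totalComplexity, entriesRead_rulerEstimate, Set.ncard_coe_finset]

/-! ### Sample complexity of the square-root ruler -/

lemma solvesCovariance_of_failureProb_le {d n : ℕ} {R : Finset (Fin d)}
    {T : Matrix (Fin d) (Fin d) ℝ} {ε δ : ℝ} (h : failureProb R T n ε ≤ δ) :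
    SolvesCovariance R T n ε δ := by
  have : IsProbabilityMeasure (sampleLaw n T) := by unfold sampleLaw; infer_instance
  have hun : {x : Fin n → EuclideanSpace ℝ (Fin d) |
      specNorm (T - rulerEstimate R x) ≤ ε * specNorm T} ∪
      {x | ε * specNorm T < specNorm (T - rulerEstimate R x)} = Set.univ :=
    Set.eq_univ_of_forall fun x => le_or_gt (specNorm (T - rulerEstimate R x)) _
  have h1 := measureReal_union_le (μ := sampleLaw n T)
    {x : Fin n → EuclideanSpace ℝ (Fin d) | specNorm (T - rulerEstimate R x) ≤ ε * specNorm T}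
    {x | ε * specNorm T < specNorm (T - rulerEstimate R x)}
  rw [hun, probReal_univ] at h1
  rw [SolvesCovariance]
  rw [failureProb] at h
  linarith

lemma log_natCast_le_two_mul_sqrt (d : ℕ) : Real.log d ≤ 2 * √d := by
  have h := Real.log_le_self (Real.sqrt_nonneg (d : ℝ))
  rw [Real.log_sqrt (Nat.cast_nonneg d)] at h
  linarith

/-- For the square-root ruler the tail is governed by `min (k ^ 2, d)`. -/
lemma failureProb_le_min {d k : ℕ} (hk : 1 ≤ k) (hkd : k ≤ d) {R : Finset (Fin d)}
    (hR : IsAlphaRuler d (1 / 2) R) {T : Matrix (Fin d) (Fin d) ℝ} (hT : T.PosSemidef)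
    (hToep : IsSymmToeplitz T) {ε : ℝ} (hε : 0 < ε) (hε1 : ε ≤ 1)
    (h : T.rank = k ∨ ∃ Tk, IsTruncatedSVD T k Tk ∧
      (√d / (k : ℝ) ^ 2 * frobNorm (T - Tk) ^ 2 ≤ specNorm T ^ 2 ∨
        (d : ℝ) / (k : ℝ) ^ 2 * specNorm (T - Tk) ^ 2 ≤ specNorm T ^ 2)) (n : ℕ) :
    failureProb R T n ε ≤
      4 * d * Real.exp (-(n * ε ^ 2 / (55296 * min ((k : ℝ) ^ 2) d))) := by
  have hd : 0 < d := by omega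
  have hd0 : (0 : ℝ) < d := Nat.cast_pos.mpr hd
  have hd1 : (1 : ℝ) ≤ d := by exact_mod_cast hd
  have hk1 : (1 : ℝ) ≤ k := by exact_mod_cast hk
  have hk2 : (1 : ℝ) ≤ (k : ℝ) ^ 2 := one_le_pow₀ hk1
  by_cases hT0 : T = 0
  · rw [hT0, failureProb_zero]; positivity
  have hτ := specNorm_pos_of_ne_zero hT0
  set τ := specNorm T with hτdef
  have hlog : 0 ≤ Real.log d := Real.log_natCast_nonneg d
  have hlog2 := log_natCast_le_two_mul_sqrt d
  have hpow : (d : ℝ) ^ (1 - 1 / 2 : ℝ) = √d := by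
    rw [Real.sqrt_eq_rpow]; norm_num
  have hs : 0 < √(d : ℝ) := Real.sqrt_pos.mpr hd0
  have hss : √(d : ℝ) ^ 2 = d := Real.sq_sqrt hd0.le
  have hL : 1 + Real.log d / √d ≤ 3 := by
    have : Real.log d / √d ≤ 2 := by rw [div_le_iff₀ hs]; exact hlog2
    linarith
  have hD : √(d : ℝ) ^ 2 + √d * Real.log d ≤ 3 * d := by
    nlinarith [mul_le_mul_of_nonneg_left hlog2 hs.le]
  have hτ2 : 0 < τ ^ 2 := by positivity
  have hkτ : τ ^ 2 ≤ (k : ℝ) ^ 2 * τ ^ 2 := le_mul_of_one_le_left hτ2.le hk2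
  have hdτ : τ ^ 2 ≤ d * τ ^ 2 := le_mul_of_one_le_left hτ2.le hd1
  -- The largest demand on `G` comes from the Frobenius case: `864 · 3 + 96 · 9 = 3456`.
  have hform : ∀ M : ℝ, 0 < M → (n : ℝ) * (ε * τ) ^ 2 / (16 * (3456 * (M * τ ^ 2))) =
      n * ε ^ 2 / (55296 * M) := fun M hM => by field_simp; ring
  have hkL : 864 * ((k : ℝ) ^ 2 * τ ^ 2 * (1 + Real.log d / √d)) ≤
      2592 * ((k : ℝ) ^ 2 * τ ^ 2) := by
    nlinarith [mul_le_mul_of_nonneg_left hL (by positivity : 0 ≤ (k : ℝ) ^ 2 * τ ^ 2)]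
  -- The trivial splitting `B = 0`, `E = T`, valid for every `T`.
  have hbound_d : failureProb R T n ε ≤ 4 * d * Real.exp (-(n * ε ^ 2 / (55296 * d))) := by
    rw [← hform d hd0]
    refine failureProb_le_of_add hd hR hT hToep (zero_add T).symm Matrix.PosSemidef.zero
      le_rfl (by simp) hτ.le (Or.inl le_rfl) hε hε1 (by positivity) (by linarith) ?_ n
    rw [hpow]
    nlinarith [mul_le_mul_of_nonneg_left hD hτ2.le]
  have hbound_k : failureProb R T n ε ≤
      4 * d * Real.exp (-(n * ε ^ 2 / (55296 * (k : ℝ) ^ 2))) := by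
    rw [← hform ((k : ℝ) ^ 2) (by positivity)]
    rcases h with hrank | ⟨Tk, hTk, hF | hS⟩
    · refine failureProb_le_of_add hd hR hT hToep (add_zero T).symm hT (κ := k) (e := 0)
        (Nat.cast_nonneg k) ?_ le_rfl (Or.inl ?_) hε hε1 (by positivity) (by linarith) ?_ n
      · rw [← hrank]; exact trace_le_rank_mul_specNorm hT.1
      · simp [specNorm]
      · rw [hpow]; linarith
    · obtain ⟨hpsd, htr⟩ := hTk.posSemidef_and_trace_le hT
      have hF2 : √(d : ℝ) * frobNorm (T - Tk) ^ 2 ≤ (k : ℝ) ^ 2 * τ ^ 2 := by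
        rw [div_mul_eq_mul_div, div_le_iff₀ (by positivity)] at hF
        linarith
      have he : √(3 * frobNorm (T - Tk) ^ 2 / √d) ^ 2 = 3 * frobNorm (T - Tk) ^ 2 / √d :=
        Real.sq_sqrt (by positivity)
      refine failureProb_le_of_add hd hR hT hToep (add_sub_cancel _ _).symm hpsd
        (Nat.cast_nonneg k) htr (Real.sqrt_nonneg (3 * frobNorm (T - Tk) ^ 2 / √d)) (Or.inr ?_)
        hε hε1 (by positivity) (by linarith) ?_ n
      · rw [he, hpow, mul_div_cancel₀ _ hs.ne']
      · rw [he, hpow]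
        have h2 : 3 * frobNorm (T - Tk) ^ 2 / √d * (√d ^ 2 + √d * Real.log d) ≤
            9 * ((k : ℝ) ^ 2 * τ ^ 2) := by
          calc _ ≤ 3 * frobNorm (T - Tk) ^ 2 / √d * (3 * d) := by gcongr
            _ = 9 * (√(d : ℝ) * frobNorm (T - Tk) ^ 2) := by
              rw [div_mul_eq_mul_div, div_eq_iff hs.ne']
              linear_combination (-9 * frobNorm (T - Tk) ^ 2) * hss
            _ ≤ _ := by linarith
        linarith
    · obtain ⟨hpsd, htr⟩ := hTk.posSemidef_and_trace_le hT
      have hS2 : (d : ℝ) * specNorm (T - Tk) ^ 2 ≤ (k : ℝ) ^ 2 * τ ^ 2 := by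
        rw [div_mul_eq_mul_div, div_le_iff₀ (by positivity)] at hS
        linarith
      refine failureProb_le_of_add hd hR hT hToep (add_sub_cancel _ _).symm hpsd
        (Nat.cast_nonneg k) htr (specNorm_nonneg (T - Tk)) (Or.inl le_rfl)
        hε hε1 (by positivity) (by linarith) ?_ n
      rw [hpow]
      nlinarith [mul_le_mul_of_nonneg_left hD (sq_nonneg (specNorm (T - Tk)))]
  rcases min_choice ((k : ℝ) ^ 2) d with hm | hm <;> rw [hm] <;> assumption

/-- Since `165888 = 3 · 55296`, the exponential is at most `y⁻³` with `y = d / (ε δ)`; two factors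
`y ≥ 2` absorb the 4 and the third absorbs `d / δ`. -/
lemma four_mul_mul_exp_le {d n : ℕ} {M ε δ : ℝ} (hd : 2 ≤ d) (hM : 0 < M) (hε : 0 < ε)
    (hε1 : ε ≤ 1) (hδ : 0 < δ) (hδ1 : δ < 1)
    (hn : 165888 * (M * Real.log (d / (ε * δ)) / ε ^ 2) ≤ n) :
    4 * d * Real.exp (-(n * ε ^ 2 / (55296 * M))) ≤ δ := by
  have hd2 : (2 : ℝ) ≤ d := by exact_mod_cast hd
  set y := (d : ℝ) / (ε * δ) with hy
  have hy0 : 0 < y := by positivity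
  have hdy : (d : ℝ) / δ ≤ y := by
    rw [hy]
    exact div_le_div_of_nonneg_left (by positivity) (by positivity) (mul_le_of_le_one_left hδ.le hε1)
  have hddy : (d : ℝ) ≤ d / δ := by
    rw [le_div_iff₀ hδ]; nlinarith
  have h2y : 2 ≤ y := by linarith
  have h3 : 3 * Real.log y ≤ n * ε ^ 2 / (55296 * M) := by
    rw [le_div_iff₀ (by positivity)]
    have := mul_le_mul_of_nonneg_right hn (sq_nonneg ε)
    have he : 165888 * (M * Real.log y / ε ^ 2) * ε ^ 2 = 165888 * (M * Real.log y) := by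
      field_simp
    rw [he] at this
    linarith
  have hexp : Real.exp (-(n * ε ^ 2 / (55296 * M))) ≤ (y ^ 3)⁻¹ := by
    rw [← Real.exp_log (by positivity : 0 < (y ^ 3)⁻¹), Real.log_inv, Real.log_pow]
    exact Real.exp_le_exp.mpr (neg_le_neg (by push_cast; exact h3))
  calc 4 * d * Real.exp (-(n * ε ^ 2 / (55296 * M))) ≤ 4 * d * (y ^ 3)⁻¹ := by gcongr
    _ ≤ δ := by
      rw [← div_eq_mul_inv, div_le_iff₀ (by positivity), mul_comm δ, ← div_le_iff₀ hδ]
      calc 4 * (d : ℝ) / δ = 2 * 2 * (d / δ) := by ring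
        _ ≤ y * y * y := by gcongr
        _ = y ^ 3 := by ring

theorem exists_sampleComplexity {d k : ℕ} {ε δ : ℝ} {R : Finset (Fin d)} (hd : 2 ≤ d)
    (hk : 1 ≤ k) (hkd : k ≤ d) (hε : 0 < ε) (hε1 : ε ≤ 1) (hδ : 0 < δ) (hδ1 : δ < 1)
    (hR : IsAlphaRuler d (1 / 2) R) :
    ∃ n₀ : ℕ, 1 ≤ n₀ ∧
      (n₀ : ℝ) ≤ 1000000 * (min ((k : ℝ) ^ 2) d * Real.log (d / (ε * δ)) / ε ^ 2) ∧
      (totalComplexity (rulerEstimate (n := n₀) R) : ℝ) ≤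
        1000000 * (√d * min ((k : ℝ) ^ 2) d * Real.log (d / (ε * δ)) / ε ^ 2) ∧
      ∀ n : ℕ, n₀ ≤ n →
        1 / 30720 * √d ≤ entryComplexity (rulerEstimate (n := n) R) ∧
        (entryComplexity (rulerEstimate (n := n) R) : ℝ) ≤ 1000000 * √d ∧
        ∀ T : Matrix (Fin d) (Fin d) ℝ, T.PosSemidef → IsSymmToeplitz T →
          (T.rank = k ∨ ∃ Tk, IsTruncatedSVD T k Tk ∧
            (√d / (k : ℝ) ^ 2 * frobNorm (T - Tk) ^ 2 ≤ specNorm T ^ 2 ∨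
              (d : ℝ) / (k : ℝ) ^ 2 * specNorm (T - Tk) ^ 2 ≤ specNorm T ^ 2)) →
          SolvesCovariance R T n ε δ := by
  have hd2 : (2 : ℝ) ≤ d := by exact_mod_cast hd
  have hk1 : (1 : ℝ) ≤ k := by exact_mod_cast hk
  set M := min ((k : ℝ) ^ 2) d with hMdef
  have hM1 : 1 ≤ M := le_min (one_le_pow₀ hk1) (by linarith)
  set X := M * Real.log (d / (ε * δ)) / ε ^ 2 with hX
  have hlog : 1 / 2 ≤ Real.log (d / (ε * δ)) := by
    have h2 : (2 : ℝ) ≤ d / (ε * δ) := by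
      rw [le_div_iff₀ (by positivity)]
      nlinarith [mul_le_one₀ hε1 hδ.le hδ1.le]
    have := Real.log_le_log two_pos h2
    linarith [Real.log_two_gt_d9]
  -- With `X` bounded below, rounding up to an integer costs at most `2X`.
  have hX1 : 1 / 2 ≤ X := by
    rw [hX, le_div_iff₀ (by positivity)]
    nlinarith [pow_le_one₀ (n := 2) hε.le hε1]
  obtain ⟨p, m, q, hRc, -, -, hpd, -, -, -, -, hcard⟩ := hR.exists_combRuler (by omega)
  obtain ⟨hlow, hup⟩ := hcard rfl
  have hs : 0 ≤ √(d : ℝ) := Real.sqrt_nonneg _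
  have hcard_low : √(d : ℝ) ≤ R.card := hlow.trans (by
    rw [hRc]; exact_mod_cast le_combRuler_card m q hpd)
  have hcard_up : (R.card : ℝ) ≤ 4 * √d := le_trans (by
    rw [hRc]; exact_mod_cast combRuler_card_le d p m q) hup
  have hn₀ : (⌈165888 * X⌉₊ : ℝ) ≤ 165890 * X := by
    have := (Nat.ceil_lt_add_one (by positivity : 0 ≤ 165888 * X)).le
    linarith
  have hn₁ : 1 ≤ ⌈165888 * X⌉₊ := Nat.one_le_ceil_iff.mpr (by positivity)
  refine ⟨⌈165888 * X⌉₊, hn₁, by linarith, ?_, fun n hn => ⟨?_, ?_, ?_⟩⟩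
  · rw [totalComplexity_rulerEstimate, Nat.cast_mul]
    calc (⌈165888 * X⌉₊ : ℝ) * R.card ≤ 165890 * X * (4 * √d) := by gcongr
      _ = 663560 * (√d * X) := by ring
      _ ≤ 1000000 * (√d * X) := by gcongr; norm_num
      _ = _ := by rw [hX]; ring
  · rw [entryComplexity_rulerEstimate (by omega)]; linarith
  · rw [entryComplexity_rulerEstimate (by omega)]; linarith
  · intro T hT hToep h
    refine solvesCovariance_of_failureProb_le
      ((failureProb_le_min hk hkd hR hT hToep hε hε1 h n).trans ?_)
    exact four_mul_mul_exp_le hd (by linarith) hε hε1 hδ hδ1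
      ((Nat.le_ceil _).trans (Nat.cast_le.mpr hn))

end ToeplitzRuler

theorem mainTheorem3 :
    ∃ C c : ℝ, 0 < C ∧ 0 < c ∧
      -- failure probability, spectral tail and Frobenius tail
      (∀ (d k n : ℕ) (α ε : ℝ) (R : Finset (Fin d)) (T Tk : Matrix (Fin d) (Fin d) ℝ),
        1 ≤ k → k ≤ d → IsAlphaRuler d α R → 0 < ε → ε ≤ 1 →
        T.PosSemidef → IsSymmToeplitz T → IsTruncatedSVD T k Tk →
        failureProb R T n ε ≤ C * (d : ℝ) ^ 2 / ε *
            Real.exp (-(c * n * ε ^ 2 *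
              minRate (1 / ((k : ℝ) ^ 2 * (1 + Real.log d / (d : ℝ) ^ (1 - α))))
                (specNorm T ^ 2)
                (((d : ℝ) ^ (2 - 2 * α) + (d : ℝ) ^ (1 - α) * Real.log d) *
                  specNorm (T - Tk) ^ 2))) ∧
        failureProb R T n ε ≤ C * (d : ℝ) ^ 2 / ε *
            Real.exp (-(c * n * ε ^ 2 *
              minRate (1 / ((k : ℝ) ^ 2 * (1 + Real.log d / (d : ℝ) ^ (1 - α))))
                (specNorm T ^ 2)
                (((d : ℝ) ^ (1 - α) + Real.log d) * frobNorm (T - Tk) ^ 2)))) ∧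
      -- sample complexities for `α = 1/2`
      (∀ (d k : ℕ) (ε δ : ℝ) (R : Finset (Fin d)),
        2 ≤ d → 1 ≤ k → k ≤ d → 0 < ε → ε ≤ 1 → 0 < δ → δ < 1 → IsAlphaRuler d (1 / 2) R →
        ∃ n₀ : ℕ, 1 ≤ n₀ ∧
          (n₀ : ℝ) ≤ C * (min ((k : ℝ) ^ 2) d * Real.log (d / (ε * δ)) / ε ^ 2) ∧
          (totalComplexity (rulerEstimate (n := n₀) R) : ℝ) ≤
            C * (Real.sqrt d * min ((k : ℝ) ^ 2) d * Real.log (d / (ε * δ)) / ε ^ 2) ∧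
          ∀ n : ℕ, n₀ ≤ n →
            c * Real.sqrt d ≤ entryComplexity (rulerEstimate (n := n) R) ∧
            (entryComplexity (rulerEstimate (n := n) R) : ℝ) ≤ C * Real.sqrt d ∧
            ∀ T : Matrix (Fin d) (Fin d) ℝ, T.PosSemidef → IsSymmToeplitz T →
              (T.rank = k ∨ ∃ Tk, IsTruncatedSVD T k Tk ∧
                (Real.sqrt d / (k : ℝ) ^ 2 * frobNorm (T - Tk) ^ 2 ≤ specNorm T ^ 2 ∨
                  (d : ℝ) / (k : ℝ) ^ 2 * specNorm (T - Tk) ^ 2 ≤ specNorm T ^ 2)) →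
              SolvesCovariance R T n ε δ) := by
  refine ⟨1000000, 1 / 30720, by norm_num, by norm_num, ?_, ?_⟩
  · intro d k n α ε R T Tk hk hkd hR hε hε1 hT hToep hTk
    exact failureProb_le_tails hk hkd hR hε hε1 hT hToep hTk
  · intro d k ε δ R hd hk hkd hε hε1 hδ hδ1 hR
    exact exists_sampleComplexity hd hk hkd hε hε1 hδ hδ1 hR
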